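/- Let $A_1, A_2$ be equidimensional Noetherian local Cohen--Macaulay rings with $\dim A_1=\dim A_2$, and let $\omega_i$ be a dualizing (canonical) module of $A_i$ for $i=1,2$, i.e. a finitely generated maximal Cohen--Macaulay $A_i$-module of type one and of finite injective dimension. Let $B$ be a commutative ring which is a linkage extension of $A_1$ and $A_2$; that is, suppose there are exact sequences of abelian groups $$0\to \omega_2 \xrightarrow{\,i_2\,} B \xrightarrow{\,p_1\,} A_1\to 0, \qquad 0\to \omega_1 \xrightarrow{\,i_1\,} B \xrightarrow{\,p_2\,} A_2\to 0,$$ in which $p_1$ and $p_2$ are ring homomorphisms and $$b\,i_1(x_1)=i_1(p_1(b)\,x_1),\qquad b\,i_2(x_2)=i_2(p_2(b)\,x_2)\qquad\text{for all } b\in B,\ x_1\in\omega_1,\ x_2\in\omega_2.$$ Then $B$ is a Gorenstein ring; that is, $B$ is Noetherian and, for every maximal ideal $\mathfrak m$ of $B$, the local ring $B_{\mathfrak m}$ has finite injective dimension as a module over itself. -/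

import Mathlib

universe u₁ u₂ v

namespace LinkageExtension

open CategoryTheory

/-- The depth of a module `M` over a local ring `A`: the supremum of the lengths of the
`M`-regular sequences contained in the maximal ideal. -/
noncomputable def depth (A : Type*) [CommRing A] [IsLocalRing A]
    (M : Type*) [AddCommGroup M] [Module A M] : ℕ∞ :=
  ⨆ (rs : List A) (_ : (∀ r ∈ rs, r ∈ IsLocalRing.maximalIdeal A) ∧
    RingTheory.Sequence.IsRegular M rs), (rs.length : ℕ∞)

/-- A local ring is Cohen-Macaulay if it is Noetherian and its depth is its Krull dimension. -/
structure IsCohenMacaulayLocalRing (A : Type*) [CommRing A] [IsLocalRing A] : Prop where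
  isNoetherianRing : IsNoetherianRing A
  depth_eq : (depth A A : WithBot ℕ∞) = ringKrullDim A

/-- A ring is equidimensional if all its irreducible components have the same dimension
(namely that of the ring). -/
def IsEquidimensional (A : Type*) [CommRing A] : Prop :=
  ∀ p ∈ minimalPrimes A, ringKrullDim (A ⧸ p) = ringKrullDim A

/-- `ω` is a dualizing (canonical) module of the Cohen-Macaulay local ring `A`: it is a
finitely generated maximal Cohen-Macaulay module, of finite injective dimension and of type one,
that is `Ext^d(k, ω)` is a one-dimensional vector space over the residue field `k`,
where `d = dim A`. -/
structure IsDualizingModule (A : Type v) [CommRing A] [IsLocalRing A]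
    (ω : Type v) [AddCommGroup ω] [Module A ω] : Prop where
  finite : Module.Finite A ω
  depth_eq : (depth A ω : WithBot ℕ∞) = ringKrullDim A
  injectiveDimension_lt_top : injectiveDimension (ModuleCat.of A ω) < ⊤
  type_eq_one : ∀ d : ℕ, ringKrullDim A = (d : WithBot ℕ∞) →
    Nonempty (Abelian.Ext (ModuleCat.of A (IsLocalRing.ResidueField A)) (ModuleCat.of A ω) d
      ≃ₗ[A] IsLocalRing.ResidueField A)

/-- A Noetherian local ring is Gorenstein if it has finite injective dimension as a module over
itself. -/
structure IsGorensteinLocalRing (R : Type v) [CommRing R] : Prop where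
  isLocalRing : IsLocalRing R
  isNoetherianRing : IsNoetherianRing R
  injectiveDimension_lt_top : injectiveDimension (ModuleCat.of R R) < ⊤

/-- A ring is Gorenstein if it is Noetherian and its localizations at all maximal ideals are
Gorenstein local rings. -/
structure IsGorensteinRing (B : Type v) [CommRing B] : Prop where
  isNoetherianRing : IsNoetherianRing B
  localization : ∀ (P : Ideal B) [P.IsMaximal], IsGorensteinLocalRing (Localization.AtPrime P)

/-- A double extension of `A₁` by the `A₂`-module `M₂` and of `A₂` by the `A₁`-module `M₁`:
exact sequences `0 → M₂ → B → A₁ → 0` and `0 → M₁ → B → A₂ → 0`, where the maps from `B` are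
ring homomorphisms, with `b * i₁ x = i₁ (p₁ b • x)` and `b * i₂ x = i₂ (p₂ b • x)`. -/
structure DoubleExtension (A₁ A₂ M₁ M₂ B : Type*) [CommRing A₁] [CommRing A₂] [CommRing B]
    [AddCommGroup M₁] [Module A₁ M₁] [AddCommGroup M₂] [Module A₂ M₂] where
  i₁ : M₁ →+ B
  i₂ : M₂ →+ B
  p₁ : B →+* A₁
  p₂ : B →+* A₂
  injective_i₁ : Function.Injective i₁
  injective_i₂ : Function.Injective i₂
  exact₁ : Function.Exact i₂ p₁
  exact₂ : Function.Exact i₁ p₂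
  surjective_p₁ : Function.Surjective p₁
  surjective_p₂ : Function.Surjective p₂
  mul_i₁ : ∀ (b : B) (x : M₁), b * i₁ x = i₁ (p₁ b • x)
  mul_i₂ : ∀ (b : B) (x : M₂), b * i₂ x = i₂ (p₂ b • x)

end LinkageExtension

/-!
Write `I₁ = i₁(ω₁) = ker p₂` and `I₂ = i₂(ω₂) = ker p₁`. These are ideals of `B` with
`I₁ I₂ = 0`, so every maximal ideal `P` of `B` contains one of them.

If `P` contains only `I₂`, then localizing at `P` kills `I₂`, so `B_P` is `A₁`; moreover `ω₁` is
then free of rank one over `A₁`, so that `A₁` is its own dualizing module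
(`isGorensteinLocalRing_of_not_le`).

If `P` contains both, then `B` is local. The modules `A₁`, `A₂`, `ω₁`, `ω₂` and `B` have depth at
least `d = dim A₁ = dim A₂` over `B`, so they have a common regular sequence `rs` of length `d`.
An element of the socle of `B ⧸ (rs)` annihilates `ω₁ ⧸ (rs) ω₁`, which is faithful over
`A₁ ⧸ (rs)` (`mem_ofList_of_smul_mem`), so it comes from the socle of `ω₂ ⧸ (rs) ω₂`, which is
simple because `ω₂` has type one (`exists_socle_generator`). Thus the socle of the Artinian ring
`B ⧸ (rs)` is generated by one element (`DoubleExtension.hasGorensteinReduction`).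

Both the faithfulness and the passage from a simple socle of `R ⧸ (rs)` to finite injective
dimension of `R` (`HasGorensteinReduction.injectiveDimension_lt_top`) come from comparing the length
of `Ext^d(R ⧸ I, M)` with that of `R ⧸ I`, for the ideals `I` containing `rs`. The comparison is a
dévissage along the exact sequences `0 → R ⧸ (I : a) → R ⧸ I → R ⧸ (I + (a)) → 0`
(`colon_induction`, `sup_induction`), and `Ext^d(R ⧸ I, M)` is computed by shifting dimension along
`rs` as `Hom(R ⧸ I, M ⧸ (rs) M)` (`nonempty_ext_length_equiv`).
-/

universe u

namespace LinkageExtension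

open CategoryTheory Abelian IsLocalRing RingTheory.Sequence

/-! ### Cyclic modules and colon ideals -/

section Colon

variable {R : Type u} [CommRing R] (I : Ideal R) (a : R)

/-- Multiplication by `a`, as an injection `R ⧸ (I : a) → R ⧸ I`. -/
noncomputable def colonMul : (R ⧸ I.colon {a}) →ₗ[R] (R ⧸ I) :=
  Submodule.mapQ _ _ (LinearMap.mulRight R a) fun r hr => by simpa using hr

lemma colonMul_mk (r : R) :
    colonMul I a (Ideal.Quotient.mk _ r) = Ideal.Quotient.mk I (r * a) := rfl

lemma colonMul_injective : Function.Injective (colonMul I a) := by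
  rw [injective_iff_map_eq_zero]
  intro x hx
  obtain ⟨r, rfl⟩ := Ideal.Quotient.mk_surjective x
  rw [colonMul_mk, Ideal.Quotient.eq_zero_iff_mem] at hx
  rw [Ideal.Quotient.eq_zero_iff_mem]
  simpa using hx

lemma colonMul_exact :
    Function.Exact (colonMul I a)
      (Submodule.factor (le_sup_left : I ≤ I ⊔ Ideal.span {a})) := by
  intro x
  obtain ⟨r, rfl⟩ := Ideal.Quotient.mk_surjective x
  have h : Submodule.factor (le_sup_left : I ≤ I ⊔ Ideal.span {a}) (Ideal.Quotient.mk I r) = 0 ↔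
      r ∈ I ⊔ Ideal.span {a} := Ideal.Quotient.eq_zero_iff_mem
  rw [h]
  constructor
  · intro hr
    obtain ⟨y, hy, z, hz, rfl⟩ := Submodule.mem_sup.mp hr
    obtain ⟨c, rfl⟩ := Ideal.mem_span_singleton'.mp hz
    refine ⟨Ideal.Quotient.mk _ c, ?_⟩
    rw [colonMul_mk, Ideal.Quotient.eq]
    simpa using I.neg_mem hy
  · rintro ⟨y, hy⟩
    obtain ⟨c, rfl⟩ := Ideal.Quotient.mk_surjective y
    rw [colonMul_mk, Ideal.Quotient.eq] at hy
    have : r = -(c * a - r) + c * a := by ring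
    rw [this]
    exact add_mem (Ideal.mem_sup_left (I.neg_mem hy))
      (Ideal.mem_sup_right (Ideal.mem_span_singleton'.mpr ⟨c, rfl⟩))

/-- The short exact sequence `0 → R ⧸ (I : a) → R ⧸ I → R ⧸ (I + (a)) → 0`. -/
noncomputable abbrev colonShortComplex : ShortComplex (ModuleCat.{u} R) :=
  ModuleCat.shortComplexOfCompEqZero (colonMul I a)
    (Submodule.factor (le_sup_left : I ≤ I ⊔ Ideal.span {a}))
    (colonMul_exact I a).linearMap_comp_eq_zero

lemma colonShortComplex_shortExact : (colonShortComplex I a).ShortExact :=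
  ModuleCat.shortComplex_shortExact _ (colonMul_exact I a) (colonMul_injective I a)
    (Submodule.factor_surjective (le_sup_left : I ≤ I ⊔ Ideal.span {a}))

lemma length_quotient_eq_add :
    Module.length R (R ⧸ I) =
      Module.length R (R ⧸ I.colon {a}) + Module.length R (R ⧸ I ⊔ Ideal.span {a}) :=
  Module.length_eq_add_of_exact _ _ (colonMul_injective I a)
    (Submodule.factor_surjective (le_sup_left : I ≤ I ⊔ Ideal.span {a}))
    (colonMul_exact I a)

end Colon

/-! ### Extension groups of cyclic modules -/

section CyclicExt

variable {R : Type u} [CommRing R]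

/-- `Ext^n(R ⧸ I, M)`. -/
abbrev CyclicExt (n : ℕ) (I : Ideal R) (M : ModuleCat.{u} R) : Type u :=
  Ext (ModuleCat.of R (R ⧸ I)) M n

/-- The map `Ext^n(R ⧸ I, M) → Ext^n(R ⧸ (I : a), M)` induced by multiplication by `a`. -/
noncomputable def colonRestrict (n : ℕ) (I : Ideal R) (a : R) (M : ModuleCat.{u} R) :
    CyclicExt n I M →ₗ[R] CyclicExt n (I.colon {a}) M :=
  (Ext.mk₀ (colonShortComplex I a).f).precompOfLinear R M (zero_add n)

/-- The map `Ext^n(R ⧸ (I + (a)), M) → Ext^n(R ⧸ I, M)` induced by the projection. -/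
noncomputable def supInflate (n : ℕ) (I : Ideal R) (a : R) (M : ModuleCat.{u} R) :
    CyclicExt n (I ⊔ Ideal.span {a}) M →ₗ[R] CyclicExt n I M :=
  (Ext.mk₀ (colonShortComplex I a).g).precompOfLinear R M (zero_add n)

lemma subsingleton_cyclicExt_top (n : ℕ) (M : ModuleCat.{u} R) :
    Subsingleton (CyclicExt n ⊤ M) := by
  have : Subsingleton (R ⧸ (⊤ : Ideal R)) := Ideal.Quotient.subsingleton_iff.mpr rfl
  have h0 : Limits.IsZero (ModuleCat.of R (R ⧸ (⊤ : Ideal R))) :=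
    ModuleCat.isZero_of_subsingleton _
  refine subsingleton_of_forall_eq 0 fun x => ?_
  rw [← Ext.mk₀_id_comp x, h0.eq_zero_of_src (𝟙 _), Ext.mk₀_zero, Ext.zero_comp]

variable (n : ℕ) (I : Ideal R) (a : R) (M : ModuleCat.{u} R)

lemma exact_supInflate_colonRestrict :
    Function.Exact (supInflate n I a M) (colonRestrict n I a M) := by
  intro x
  constructor
  · intro hx
    exact Ext.contravariant_sequence_exact₂ (colonShortComplex_shortExact I a) M x hx
  · rintro ⟨y, rfl⟩
    change (Ext.mk₀ (colonShortComplex I a).f).comp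
      ((Ext.mk₀ (colonShortComplex I a).g).comp y (zero_add n)) (zero_add n) = 0
    rw [Ext.mk₀_comp_mk₀_assoc, ShortComplex.zero, Ext.mk₀_zero, Ext.zero_comp]

lemma supInflate_zero_injective : Function.Injective (supInflate 0 I a M) := by
  have := (colonShortComplex_shortExact I a).epi_g
  exact Ext.precomp_mk₀_injective_of_epi M (colonShortComplex I a).g

variable {n I a M}

lemma supInflate_succ_injective (h : Function.Surjective (colonRestrict n I a M)) :
    Function.Injective (supInflate (n + 1) I a M) := by
  rw [injective_iff_map_eq_zero]
  intro x hx
  obtain ⟨y, rfl⟩ := Ext.contravariant_sequence_exact₃ (colonShortComplex_shortExact I a) M x hx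
    (add_comm 1 n)
  obtain ⟨z, rfl⟩ := h y
  exact (colonShortComplex_shortExact I a).extClass_comp_assoc z

lemma colonRestrict_surjective [Subsingleton (CyclicExt (n + 1) (I ⊔ Ideal.span {a}) M)] :
    Function.Surjective (colonRestrict n I a M) := fun x =>
  Ext.contravariant_sequence_exact₁ (colonShortComplex_shortExact I a) M x (add_comm 1 n)
    (Subsingleton.elim _ _)

lemma subsingleton_cyclicExt_of_colon_of_sup
    (h₁ : Subsingleton (CyclicExt n (I ⊔ Ideal.span {a}) M))
    (h₂ : Subsingleton (CyclicExt n (I.colon {a}) M)) : Subsingleton (CyclicExt n I M) := by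
  refine subsingleton_of_forall_eq 0 fun x => ?_
  obtain ⟨y, rfl⟩ := (exact_supInflate_colonRestrict n I a M x).mp (Subsingleton.elim _ _)
  rw [Subsingleton.elim y 0, map_zero]

lemma subsingleton_cyclicExt_sup (h : Function.Surjective (colonRestrict n I a M))
    (h' : Subsingleton (CyclicExt (n + 1) I M)) :
    Subsingleton (CyclicExt (n + 1) (I ⊔ Ideal.span {a}) M) :=
  (supInflate_succ_injective h).subsingleton

lemma subsingleton_cyclicExt_colon (h₁ : Subsingleton (CyclicExt n I M))
    (h₂ : Subsingleton (CyclicExt (n + 1) (I ⊔ Ideal.span {a}) M)) :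
    Subsingleton (CyclicExt n (I.colon {a}) M) :=
  colonRestrict_surjective.subsingleton

lemma length_cyclicExt_le :
    Module.length R (CyclicExt n I M) ≤ Module.length R (CyclicExt n (I.colon {a}) M) +
      Module.length R (CyclicExt n (I ⊔ Ideal.span {a}) M) := by
  rw [Module.length_eq_add_of_exact (LinearMap.ker (colonRestrict n I a M)).subtype
    (colonRestrict n I a M).rangeRestrict (Submodule.subtype_injective _)
    (LinearMap.surjective_rangeRestrict _) (by
      intro x; simp [LinearMap.mem_ker, Subtype.ext_iff]), add_comm]
  gcongr
  · exact Module.length_le_of_injective _ (Submodule.subtype_injective _)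
  · have : LinearMap.ker (colonRestrict n I a M) = LinearMap.range (supInflate n I a M) :=
      (exact_supInflate_colonRestrict n I a M).linearMap_ker_eq
    rw [this]
    exact Module.length_le_of_surjective _ (LinearMap.surjective_rangeRestrict _)

lemma length_cyclicExt_eq_add (h₁ : Function.Injective (supInflate n I a M))
    (h₂ : Function.Surjective (colonRestrict n I a M)) :
    Module.length R (CyclicExt n I M) = Module.length R (CyclicExt n (I.colon {a}) M) +
      Module.length R (CyclicExt n (I ⊔ Ideal.span {a}) M) := by
  rw [add_comm]
  exact Module.length_eq_add_of_exact _ _ h₁ h₂ (exact_supInflate_colonRestrict n I a M)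

/-- If lengths behave as if the restriction map were onto, then it is onto. -/
lemma colonRestrict_surjective_of_length_le
    (hfin : Module.length R (CyclicExt n (I.colon {a}) M) ≠ ⊤)
    (hfin' : Module.length R (CyclicExt n (I ⊔ Ideal.span {a}) M) ≠ ⊤)
    (h : Module.length R (CyclicExt n (I.colon {a}) M) +
      Module.length R (CyclicExt n (I ⊔ Ideal.span {a}) M) ≤ Module.length R (CyclicExt n I M)) :
    Function.Surjective (colonRestrict n I a M) := by
  rw [← LinearMap.range_eq_top]
  by_contra hne
  rw [Module.length_ne_top_iff, isFiniteLength_iff_isNoetherian_isArtinian] at hfin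
  obtain ⟨_, _⟩ := hfin
  have hlt := Submodule.length_lt hne
  rw [Module.length_eq_add_of_exact (LinearMap.ker (colonRestrict n I a M)).subtype
    (colonRestrict n I a M).rangeRestrict (Submodule.subtype_injective _)
    (LinearMap.surjective_rangeRestrict _) (by
      intro x; simp [LinearMap.mem_ker, Subtype.ext_iff]), add_comm] at h
  have hk : LinearMap.ker (colonRestrict n I a M) = LinearMap.range (supInflate n I a M) :=
      (exact_supInflate_colonRestrict n I a M).linearMap_ker_eq
  have hle : Module.length R (LinearMap.ker (colonRestrict n I a M)) ≤
      Module.length R (CyclicExt n (I ⊔ Ideal.span {a}) M) := by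
    rw [hk]
    exact Module.length_le_of_surjective _ (LinearMap.surjective_rangeRestrict _)
  exact absurd ((ENat.add_le_add_iff_left hfin').mp (h.trans (add_le_add_left hle _)))
    (not_le.mpr hlt)

end CyclicExt

/-! ### Dimension shifting along a regular sequence -/

section Shift

variable {R : Type u} [CommRing R]

lemma smul_ext_eq_zero {N M : ModuleCat.{u} R} {r : R} (hr : r ∈ Module.annihilator R N) {n : ℕ}
    (x : Ext N M n) : r • x = 0 := by
  have h : r • 𝟙 N = 0 := by
    ext y
    exact Module.mem_annihilator.mp hr y
  have : r • x = (Ext.mk₀ (r • 𝟙 N)).comp x (zero_add n) := by simp [Ext.mk₀_smul]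
  rw [this, h, Ext.mk₀_zero, Ext.zero_comp]

/-- The connecting map `Ext^n(N, M ⧸ rM) → Ext^(n+1)(N, M)` for an `M`-regular element `r`. -/
noncomputable def shiftMap {M : ModuleCat.{u} R} {r : R} (h : IsSMulRegular M r)
    (N : ModuleCat.{u} R) (n : ℕ) :
    Ext N (ModuleCat.of R (QuotSMulTop r M)) n →ₗ[R] Ext N M (n + 1) :=
  h.smulShortComplex_shortExact.extClass.postcompOfLinear R N rfl

lemma shiftMap_surjective {M : ModuleCat.{u} R} {r : R} (h : IsSMulRegular M r)
    {N : ModuleCat.{u} R} (hr : r ∈ Module.annihilator R N) (n : ℕ) :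
    Function.Surjective (shiftMap h N n) := fun x =>
  Ext.covariant_sequence_exact₁ N h.smulShortComplex_shortExact x
    ((Ext.smul_eq_comp_mk₀ x r).symm.trans (smul_ext_eq_zero hr x)) rfl

lemma shiftMap_injective {M : ModuleCat.{u} R} {r : R} (h : IsSMulRegular M r)
    {N : ModuleCat.{u} R} (n : ℕ) [Subsingleton (Ext N M n)] :
    Function.Injective (shiftMap h N n) := by
  rw [injective_iff_map_eq_zero]
  intro x hx
  obtain ⟨y, rfl⟩ := Ext.covariant_sequence_exact₃ N h.smulShortComplex_shortExact x rfl hx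
  have hy : y = 0 := Subsingleton.elim (α := Ext N M n) y 0
  rw [hy, Ext.zero_comp]
  rfl

lemma subsingleton_ext_of_isWeaklyRegular {M N : ModuleCat.{u} R} {rs : List R}
    (hrs : IsWeaklyRegular M rs) (hN : ∀ r ∈ rs, r ∈ Module.annihilator R N) {i : ℕ}
    (hi : i < rs.length) : Subsingleton (Ext N M i) := by
  induction rs generalizing M i with
  | nil => simp at hi
  | cons r rs ih =>
    rw [isWeaklyRegular_cons_iff] at hrs
    cases i with
    | zero =>
      have := IsSMulRegular.linearMap_subsingleton_of_mem_annihilator hrs.1 (hN r (by simp))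
      exact (Ext.addEquiv₀.trans ModuleCat.homAddEquiv).subsingleton
    | succ i =>
      have := ih (M := ModuleCat.of R (QuotSMulTop r M)) hrs.2 (fun s hs => hN s (by simp [hs]))
        (i := i) (by simpa using hi)
      exact (shiftMap_surjective hrs.1 (hN r (by simp)) i).subsingleton

/-- If the `M`-regular sequence `rs` annihilates `N`, then `Ext^d(N, M)` is `Hom(N, M ⧸ rs M)`,
where `d` is the length of `rs`. -/
lemma nonempty_ext_length_equiv {M N : ModuleCat.{u} R} {rs : List R}
    (hrs : IsWeaklyRegular M rs) (hN : ∀ r ∈ rs, r ∈ Module.annihilator R N) :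
    Nonempty (Ext N M rs.length ≃ₗ[R] (N →ₗ[R] (M ⧸ (Ideal.ofList rs • ⊤ : Submodule R M)))) := by
  induction rs generalizing M with
  | nil =>
    let e : M ≃ₗ[R] (M ⧸ (Ideal.ofList ([] : List R) • ⊤ : Submodule R M)) :=
      (Submodule.quotEquivOfEqBot _ (by simp)).symm
    exact ⟨Ext.linearEquiv₀.trans (ModuleCat.homLinearEquiv.trans (e.congrRight))⟩
  | cons r rs ih =>
    have hsub : Subsingleton (Ext N M rs.length) :=
      subsingleton_ext_of_isWeaklyRegular hrs hN (by simp)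
    rw [isWeaklyRegular_cons_iff] at hrs
    obtain ⟨e⟩ := ih (M := ModuleCat.of R (QuotSMulTop r M)) hrs.2
      (fun s hs => hN s (by simp [hs]))
    let δ := LinearEquiv.ofBijective (shiftMap hrs.1 N rs.length)
      ⟨shiftMap_injective hrs.1 _, shiftMap_surjective hrs.1 (hN r (by simp)) _⟩
    exact ⟨δ.symm.trans (e.trans
      (Submodule.quotOfListConsSMulTopEquivQuotSMulTopInner M r rs).symm.congrRight)⟩

end Shift

/-! ### Injective dimension and cyclic modules -/

section InjectiveDimension

variable {R : Type u} [CommRing R]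

/-- Baer's criterion in terms of `Ext`. -/
lemma injective_of_subsingleton_cyclicExt_one {M : ModuleCat.{u} R}
    (h : ∀ I : Ideal R, Subsingleton (CyclicExt 1 I M)) : Injective M := by
  suffices Module.Baer R M from Module.injective_object_of_injective_module (inj := this.injective)
  intro I g
  have hI : (ModuleCat.shortComplexOfCompEqZero I.subtype I.mkQ
      (LinearMap.exact_subtype_mkQ I).linearMap_comp_eq_zero).ShortExact :=
    ModuleCat.shortComplex_shortExact _ (LinearMap.exact_subtype_mkQ I)
      (Submodule.subtype_injective I) (Submodule.mkQ_surjective I)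
  have := h I
  obtain ⟨y, hy⟩ := Ext.contravariant_sequence_exact₁ hI M
    (Ext.mk₀ (ModuleCat.ofHom g)) (add_comm 1 0) (Subsingleton.elim (α := CyclicExt 1 I M) _ _)
  obtain ⟨f, rfl⟩ := Ext.homEquiv₀.symm.surjective y
  rw [Ext.homEquiv₀_symm_apply, Ext.mk₀_comp_mk₀] at hy
  have hfg := Ext.homEquiv₀.symm.injective hy
  refine ⟨f.hom, fun x hx => ?_⟩
  exact congrArg (fun φ => φ.hom ⟨x, hx⟩) hfg

lemma hasInjectiveDimensionLE_of_subsingleton_cyclicExt {M : ModuleCat.{u} R} {n : ℕ}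
    (h : ∀ (I : Ideal R) (i : ℕ), n < i → Subsingleton (CyclicExt i I M)) :
    HasInjectiveDimensionLE M n := by
  induction n generalizing M with
  | zero =>
    have := injective_of_subsingleton_cyclicExt_one fun I => h I 1 one_pos
    exact injective_iff_hasInjectiveDimensionLT_one.mp this
  | succ n ih =>
    let ⟨E, _, f, _⟩ := EnoughInjectives.presentation M
    have hS : (ModuleCat.shortComplexOfCompEqZero _ _
        f.hom.exact_map_mkQ_range.linearMap_comp_eq_zero).ShortExact :=
      ModuleCat.shortComplex_shortExact _ f.hom.exact_map_mkQ_range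
        ((ModuleCat.mono_iff_injective f).mp ‹_›) (Submodule.mkQ_surjective _)
    refine (hS.hasInjectiveDimensionLT_X₃_iff n ‹Injective E›).mp (ih fun I i hi => ?_)
    refine subsingleton_of_forall_eq 0 fun x => ?_
    have := h I (i + 1) (by omega)
    obtain ⟨y, rfl⟩ := Ext.covariant_sequence_exact₃ _ hS x rfl
      (Subsingleton.elim (α := CyclicExt (i + 1) I M) _ _)
    obtain ⟨i, rfl⟩ : ∃ j, i = j + 1 := ⟨i - 1, by omega⟩
    have hE : Injective (ModuleCat.of R E) := ‹Injective E›
    rw [Ext.eq_zero_of_injective y, Ext.zero_comp]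

end InjectiveDimension

/-! ### Dévissage over a local ring -/

section Local

variable {R : Type u} [CommRing R]

lemma le_colon_singleton (I : Ideal R) (a : R) : I ≤ I.colon {a} := Ideal.le_colon

variable [IsLocalRing R]

/-- Dévissage: a property of the modules `R ⧸ I`, for `I` in a range of ideals containing a power
of the maximal ideal, follows from the case of the residue field. -/
lemma colon_induction [IsNoetherianRing R] {J : Ideal R} {k : ℕ} (hJ : maximalIdeal R ^ k ≤ J)
    {P : Ideal R → Prop} (top : P ⊤) (maximal : P (maximalIdeal R))
    (step : ∀ (I : Ideal R) (a : R), J ≤ I → P (I ⊔ Ideal.span {a}) → P (I.colon {a}) → P I)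
    (I : Ideal R) (hI : J ≤ I) : P I := by
  induction I using IsNoetherian.induction with
  | hgt I ih =>
    by_cases htop : I = ⊤
    · exact htop ▸ top
    by_cases hmax : I = maximalIdeal R
    · exact hmax ▸ maximal
    obtain ⟨a, ha, haI⟩ := SetLike.exists_of_lt ((le_maximalIdeal htop).lt_of_ne hmax)
    have hle : I ≤ I.colon {a} := le_colon_singleton I a
    have hsup : I < I ⊔ Ideal.span {a} :=
      lt_of_le_of_ne le_sup_left fun h => haI (h ▸ Ideal.mem_sup_right
        (Ideal.mem_span_singleton_self a))
    refine step I a hI (ih _ hsup (hI.trans hsup.le)) (ih _ (lt_of_le_of_ne hle fun h => htop ?_)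
      (hI.trans hle))
    -- if `(I : a) = I`, then cancelling the powers of `a` from `a ^ k ∈ I` gives `1 ∈ I`
    have hpow : ∀ j, a ^ j ∈ I → (1 : R) ∈ I := by
      intro j
      induction j with
      | zero => simp
      | succ j ihj =>
        intro hj
        refine ihj ?_
        rw [h, Submodule.mem_colon_singleton, smul_eq_mul, ← pow_succ]
        exact hj
    exact (Ideal.eq_top_iff_one I).mpr (hpow k (hI (hJ (Ideal.pow_mem_pow ha k))))

/-- If all the groups `Ext^i(k, M)` with `i > n` vanish, then so do all `Ext^i(R ⧸ I, M)`. The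
case of a prime `I` is Nakayama's lemma for the finitely generated module `Ext^i(R ⧸ I, M)`. -/
lemma subsingleton_cyclicExt_of_maximalIdeal [IsNoetherianRing R] {M : ModuleCat.{u} R}
    [Module.Finite R M] {n : ℕ}
    (h : ∀ i, n < i → Subsingleton (CyclicExt i (maximalIdeal R) M)) (I : Ideal R) :
    ∀ i, n < i → Subsingleton (CyclicExt i I M) := by
  induction I using IsNoetherian.induction with
  | hgt I ih =>
    intro i hi
    by_cases hmax : I = maximalIdeal R
    · exact hmax ▸ h i hi
    by_cases htop : I = ⊤
    · exact htop ▸ subsingleton_cyclicExt_top i M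
    have hsup : ∀ a, a ∉ I → I < I ⊔ Ideal.span {a} := fun a haI =>
      lt_of_le_of_ne le_sup_left fun h => haI (h ▸ Ideal.mem_sup_right
        (Ideal.mem_span_singleton_self a))
    by_cases hprime : Ideal.IsPrime I
    · obtain ⟨a, ha, haI⟩ := SetLike.exists_of_lt ((le_maximalIdeal htop).lt_of_ne hmax)
      have hcolon : I.colon {a} = I := by
        refine le_antisymm (fun r hr => ?_) (le_colon_singleton I a)
        rw [Submodule.mem_colon_singleton, smul_eq_mul] at hr
        exact (hprime.mem_or_mem hr).resolve_right haI
      have := ih _ (hsup a haI) (i + 1) (by omega)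
      have hsurj : Function.Surjective (colonRestrict i I a M) := colonRestrict_surjective
      have hfin : Module.Finite R (CyclicExt i I M) :=
        ModuleCat.finite_ext R (ModuleCat.of R (R ⧸ I)) M i
      -- multiplication by `a` on `R ⧸ (I : a) = R ⧸ I` induces multiplication by `a` on `Ext`
      have hmul : ∀ x : CyclicExt i I M, ∃ y : CyclicExt i I M, a • y = x := by
        have key : ∀ (K : Ideal R) (hK : K = I) (f : (R ⧸ K) →ₗ[R] (R ⧸ I))
            (_ : ∀ r, f (Ideal.Quotient.mk K r) = Ideal.Quotient.mk I (r * a))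
            (_ : Function.Surjective fun y : CyclicExt i I M =>
              (Ext.mk₀ (ModuleCat.ofHom f)).comp y (zero_add i)),
            ∀ x : CyclicExt i I M, ∃ y : CyclicExt i I M, a • y = x := by
          rintro K rfl f hf hs x
          obtain ⟨y, hy⟩ := hs x
          refine ⟨y, hy ▸ ?_⟩
          have : ModuleCat.ofHom f = a • 𝟙 (ModuleCat.of R (R ⧸ K)) := by
            refine ModuleCat.hom_ext (LinearMap.ext fun z => ?_)
            obtain ⟨r, rfl⟩ := Ideal.Quotient.mk_surjective z
            change f (Ideal.Quotient.mk K r) = a • Ideal.Quotient.mk K r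
            rw [hf, mul_comm]
            rfl
          simp [this, Ext.mk₀_smul]
        exact key _ hcolon (colonMul I a) (colonMul_mk I a) hsurj
      have htop' : (⊤ : Submodule R (CyclicExt i I M)) ≤ maximalIdeal R • ⊤ := fun x _ => by
        obtain ⟨y, rfl⟩ := hmul x
        exact Submodule.smul_mem_smul ha trivial
      have := Submodule.eq_bot_of_le_smul_of_le_jacobson_bot (maximalIdeal R) ⊤
        hfin.fg_top htop' (maximalIdeal_le_jacobson _)
      exact (Submodule.subsingleton_iff R).mp (subsingleton_of_bot_eq_top this.symm)
    · rw [Ideal.isPrime_iff] at hprime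
      push Not at hprime
      obtain ⟨b, a, hba, hb, ha⟩ := hprime htop
      refine subsingleton_cyclicExt_of_colon_of_sup (a := a) (ih _ (hsup a ha) i hi)
        (ih _ ((le_colon_singleton I a).lt_of_ne fun h => hb ?_) i hi)
      rw [h, Submodule.mem_colon_singleton]
      exact hba

end Local

/-! ### Homomorphisms out of a cyclic module -/

section CyclicHom

variable {R : Type*} [CommRing R] {W : Type*} [AddCommGroup W] [Module R W] {I : Ideal R}

lemma cyclicHom_apply (f : (R ⧸ I) →ₗ[R] W) (r : R) :
    f (Ideal.Quotient.mk I r) = r • f 1 := by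
  rw [← map_smul]
  congr 1
  exact (mul_one (Ideal.Quotient.mk I r)).symm

lemma cyclicHom_ext {f g : (R ⧸ I) →ₗ[R] W} (h : f 1 = g 1) : f = g := by
  ext
  exact h

lemma smul_cyclicHom_one (f : (R ⧸ I) →ₗ[R] W) {r : R} (hr : r ∈ I) : r • f 1 = 0 := by
  rw [← cyclicHom_apply, Ideal.Quotient.eq_zero_iff_mem.mpr hr, map_zero]

lemma exists_cyclicHom {w : W} (hw : ∀ r ∈ I, r • w = 0) : ∃ f : (R ⧸ I) →ₗ[R] W, f 1 = w :=
  ⟨I.liftQ (LinearMap.toSpanSingleton R W w) hw, one_smul R w⟩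

/-- If the elements of `W` annihilated by `I` are the multiples of one of them, then
`Hom(R ⧸ I, W)` is a quotient of `R ⧸ I`. -/
lemma length_cyclicHom_le {e : W} (he : ∀ r ∈ I, r • e = 0)
    (h : ∀ w : W, (∀ r ∈ I, r • w = 0) → ∃ c : R, w = c • e) :
    Module.length R ((R ⧸ I) →ₗ[R] W) ≤ Module.length R (R ⧸ I) := by
  obtain ⟨f, hf⟩ := exists_cyclicHom he
  let φ : (R ⧸ I) →ₗ[R] ((R ⧸ I) →ₗ[R] W) :=
    I.liftQ (LinearMap.toSpanSingleton R _ f) fun r hr => cyclicHom_ext (by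
      simpa [hf] using he r hr)
  refine Module.length_le_of_surjective φ fun g => ?_
  obtain ⟨c, hc⟩ := h (g 1) fun r hr => smul_cyclicHom_one g hr
  exact ⟨Ideal.Quotient.mk I c, cyclicHom_ext (by rw [hc, ← hf]; rfl)⟩

lemma length_cyclicHom_eq (h : ∀ r ∈ I, ∀ w : W, r • w = 0) :
    Module.length R ((R ⧸ I) →ₗ[R] W) = Module.length R W :=
  (LinearEquiv.ofBijective (LinearMap.applyₗ (R := R) (1 : R ⧸ I))
    ⟨fun _ _ => cyclicHom_ext, fun w => exists_cyclicHom fun r hr => h r hr w⟩).length_eq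

end CyclicHom

/-! ### Extension groups modulo a system of parameters -/

section Reduction

variable {R : Type u} [CommRing R]

lemma mem_annihilator_of_le {I : Ideal R} {rs : List R} (hI : Ideal.ofList rs ≤ I) :
    ∀ r ∈ rs, r ∈ Module.annihilator R (ModuleCat.of R (R ⧸ I)) := fun r hr => by
  change r ∈ Module.annihilator R (R ⧸ I)
  rw [Ideal.annihilator_quotient]
  exact hI (Ideal.subset_span hr)

lemma length_cyclicExt_eq_length_cyclicHom {M : ModuleCat.{u} R} {rs : List R}
    (hrs : IsWeaklyRegular M rs) {I : Ideal R} (hI : Ideal.ofList rs ≤ I) :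
    Module.length R (CyclicExt rs.length I M) =
      Module.length R ((R ⧸ I) →ₗ[R] (M ⧸ (Ideal.ofList rs • ⊤ : Submodule R M))) := by
  obtain ⟨e⟩ := nonempty_ext_length_equiv (N := ModuleCat.of R (R ⧸ I)) hrs
    (mem_annihilator_of_le hI)
  exact e.length_eq

lemma supInflate_injective {M : ModuleCat.{u} R} {rs : List R}
    (hrs : IsWeaklyRegular M rs) {I : Ideal R} (hI : Ideal.ofList rs ≤ I) (a : R) :
    Function.Injective (supInflate rs.length I a M) := by
  rcases hn : rs.length with _ | n
  · exact supInflate_zero_injective I a M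
  · have := subsingleton_ext_of_isWeaklyRegular hrs
      (mem_annihilator_of_le (hI.trans (le_colon_singleton I a))) (i := n) (by omega)
    exact supInflate_succ_injective fun x => ⟨0, Subsingleton.elim _ _⟩

/-- Induction from an ideal to the larger ones by adding one generator at a time. -/
lemma sup_induction [IsNoetherianRing R] {J : Ideal R} {P : Ideal R → Prop} (base : P J)
    (step : ∀ (K : Ideal R) (a : R), J ≤ K → P K → P (K ⊔ Ideal.span {a}))
    (I : Ideal R) (hI : J ≤ I) : P I := by
  obtain ⟨K, ⟨hJK, hKI, hK⟩, hmax⟩ := set_has_maximal_iff_noetherian.mpr ‹IsNoetherianRing R›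
    {K : Ideal R | J ≤ K ∧ K ≤ I ∧ P K} ⟨J, le_rfl, hI, base⟩
  obtain rfl | hlt := hKI.eq_or_lt
  · exact hK
  obtain ⟨a, haI, haK⟩ := SetLike.exists_of_lt hlt
  refine absurd ?_ (hmax (K ⊔ Ideal.span {a}) ⟨hJK.trans le_sup_left,
    sup_le hKI ((Ideal.span_singleton_le_iff_mem I).mpr haI), step K a hJK hK⟩)
  exact lt_of_le_of_ne le_sup_left fun h => haK (h ▸ Ideal.mem_sup_right
    (Ideal.mem_span_singleton_self a))

variable [IsLocalRing R]

/-- A proper ideal containing a power of the maximal ideal has a socle element. -/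
lemma exists_colon_eq_maximalIdeal {J : Ideal R} {k : ℕ} (hk : maximalIdeal R ^ k ≤ J)
    (hJ : J ≠ ⊤) : ∃ s, J.colon {s} = maximalIdeal R := by
  classical
  have hex : ∃ k, maximalIdeal R ^ k ≤ J := ⟨k, hk⟩
  obtain ⟨n, hn⟩ : ∃ n, Nat.find hex = n + 1 := Nat.exists_eq_succ_of_ne_zero fun h0 => hJ <| by
    have := Nat.find_spec hex
    rw [h0, pow_zero, Ideal.one_eq_top] at this
    exact top_le_iff.mp this
  obtain ⟨s, hs, hsJ⟩ := SetLike.not_le_iff_exists.mp (Nat.find_min hex (m := n) (by omega))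
  refine ⟨s, le_antisymm (le_maximalIdeal fun h => hsJ ?_) fun r hr => ?_⟩
  · simpa using h
  · rw [Submodule.mem_colon_singleton, smul_eq_mul]
    have := Nat.find_spec hex
    rw [hn, pow_succ'] at this
    exact this (Ideal.mul_mem_mul hr hs)

lemma isSimpleModule_quotient_maximalIdeal : IsSimpleModule R (R ⧸ maximalIdeal R) :=
  isSimpleModule_iff_isCoatom.mpr (maximalIdeal.isMaximal R).out

lemma length_quotient_maximalIdeal : Module.length R (R ⧸ maximalIdeal R) = 1 :=
  Module.length_eq_one_iff.mpr isSimpleModule_quotient_maximalIdeal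

lemma length_quotient_ne_top [IsNoetherianRing R] {J : Ideal R} {k : ℕ}
    (hk : maximalIdeal R ^ k ≤ J) {I : Ideal R} (hI : J ≤ I) : Module.length R (R ⧸ I) ≠ ⊤ := by
  refine colon_induction (P := fun I => Module.length R (R ⧸ I) ≠ ⊤) hk ?_ ?_ ?_ I hI
  · have : Subsingleton (R ⧸ (⊤ : Ideal R)) := Ideal.Quotient.subsingleton_iff.mpr rfl
    simp
  · simp [length_quotient_maximalIdeal]
  · intro I a _ h₁ h₂
    rw [length_quotient_eq_add I a]
    exact WithTop.add_ne_top.mpr ⟨h₂, h₁⟩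

lemma subsingleton_cyclicExt_ofList [IsNoetherianRing R] {rs : List R}
    (hmem : ∀ r ∈ rs, r ∈ maximalIdeal R) (hrs : IsWeaklyRegular R rs) (M : ModuleCat.{u} R)
    {i : ℕ} (hi : rs.length < i) : Subsingleton (CyclicExt i (Ideal.ofList rs) M) := by
  have hpd := ModuleCat.projectiveDimension_quotient_eq_add_length_of_isWeaklyRegular
    (ModuleCat.of R R) rs hrs hmem
  rw [ModuleCat.projectiveDimension_eq_zero_of_projective (ModuleCat.of R R), zero_add] at hpd
  have e : (R ⧸ Ideal.ofList rs • (⊤ : Submodule R R)) ≃ₗ[R] (R ⧸ Ideal.ofList rs) :=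
    Submodule.quotEquivOfEq _ _ (by simp)
  rw [projectiveDimension_eq_of_iso e.toModuleIso] at hpd
  have : HasProjectiveDimensionLE (ModuleCat.of R (R ⧸ Ideal.ofList rs)) rs.length :=
    (projectiveDimension_le_iff _ _).mp hpd.le
  exact HasProjectiveDimensionLT.subsingleton _ (rs.length + 1) i hi M

/-- Over a Cohen-Macaulay local ring, finite injective dimension is at most the dimension; here
for the groups `Ext^i(R ⧸ I, M)` with `I` containing a system of parameters `rs`. By descending
induction on `i` it suffices to treat the residue field, which embeds in `R ⧸ (rs)` with cyclic
cokernel, and `R ⧸ (rs)` has projective dimension `rs.length`. -/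
lemma subsingleton_cyclicExt_of_hasInjectiveDimensionLT [IsNoetherianRing R] {rs : List R}
    (hmem : ∀ r ∈ rs, r ∈ maximalIdeal R) (hrs : IsWeaklyRegular R rs) {k : ℕ}
    (hk : maximalIdeal R ^ k ≤ Ideal.ofList rs) (M : ModuleCat.{u} R) (n : ℕ)
    [HasInjectiveDimensionLT M n] {i : ℕ} (hi : rs.length < i) {I : Ideal R}
    (hI : Ideal.ofList rs ≤ I) : Subsingleton (CyclicExt i I M) := by
  have key : ∀ c i, rs.length < i → n ≤ i + c →
      ∀ I : Ideal R, Ideal.ofList rs ≤ I → Subsingleton (CyclicExt i I M) := by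
    intro c
    induction c with
    | zero => exact fun i _ hn I _ => HasInjectiveDimensionLT.subsingleton M n i hn _
    | succ c ih =>
      intro i hi hn
      refine colon_induction hk (subsingleton_cyclicExt_top i M) ?_
        fun I a _ => subsingleton_cyclicExt_of_colon_of_sup
      have hne : Ideal.ofList rs ≠ ⊤ := fun h =>
        (maximalIdeal.isMaximal R).ne_top (top_le_iff.mp (h ▸ Ideal.span_le.mpr hmem))
      obtain ⟨s, hs⟩ := exists_colon_eq_maximalIdeal hk hne
      rw [← hs]
      exact subsingleton_cyclicExt_colon (subsingleton_cyclicExt_ofList hmem hrs M hi)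
        (ih (i + 1) (by omega) (by omega) _ le_sup_left)
  exact key n i hi (by omega) I hI

end Reduction

/-! ### Reduction of a dualizing module modulo a system of parameters -/

section Dualizing

variable {A : Type u} [CommRing A] [IsLocalRing A] {ω : Type u} [AddCommGroup ω] [Module A ω]

/-- Let `rs` be a system of parameters of a Cohen-Macaulay local ring. The reduction of a module of
type one modulo `rs` has a simple socle. -/
lemma exists_socle_generator {rs : List A} (hω : IsWeaklyRegular ω rs)
    (hmem : ∀ r ∈ rs, r ∈ maximalIdeal A)
    (htype : Nonempty (Ext (ModuleCat.of A (ResidueField A)) (ModuleCat.of A ω) rs.length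
      ≃ₗ[A] ResidueField A)) :
    ∃ e : ω, e ∉ (Ideal.ofList rs • ⊤ : Submodule A ω) ∧
      (∀ r ∈ maximalIdeal A, r • e ∈ (Ideal.ofList rs • ⊤ : Submodule A ω)) ∧
      ∀ w : ω, (∀ r ∈ maximalIdeal A, r • w ∈ (Ideal.ofList rs • ⊤ : Submodule A ω)) →
        ∃ c : A, w - c • e ∈ (Ideal.ofList rs • ⊤ : Submodule A ω) := by
  obtain ⟨φ⟩ := htype
  obtain ⟨ψ⟩ := nonempty_ext_length_equiv (M := ModuleCat.of A ω)
    (N := ModuleCat.of A (A ⧸ maximalIdeal A)) hω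
    (mem_annihilator_of_le (Ideal.span_le.mpr hmem))
  let θ : ((A ⧸ maximalIdeal A) →ₗ[A] (ω ⧸ (Ideal.ofList rs • ⊤ : Submodule A ω))) ≃ₗ[A]
    ResidueField A := ψ.symm.trans φ
  obtain ⟨e, he⟩ := Submodule.Quotient.mk_surjective _ (θ.symm 1 1)
  refine ⟨e, fun h => ?_, fun r hr => ?_, fun w hw => ?_⟩
  · rw [← Submodule.Quotient.mk_eq_zero, he] at h
    have h1 : θ.symm 1 = 0 := cyclicHom_ext h
    exact one_ne_zero ((LinearEquiv.map_eq_zero_iff _).mp h1)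
  · rw [← Submodule.Quotient.mk_eq_zero, Submodule.Quotient.mk_smul, he]
    exact smul_cyclicHom_one _ hr
  · obtain ⟨f, hf⟩ := exists_cyclicHom (I := maximalIdeal A)
      (w := Submodule.Quotient.mk (p := (Ideal.ofList rs • ⊤ : Submodule A ω)) w) fun r hr => by
        rw [← Submodule.Quotient.mk_smul, Submodule.Quotient.mk_eq_zero]
        exact hw r hr
    obtain ⟨c, hc⟩ := Ideal.Quotient.mk_surjective (θ f)
    refine ⟨c, ?_⟩
    rw [← Submodule.Quotient.mk_eq_zero, Submodule.Quotient.mk_sub, Submodule.Quotient.mk_smul, he,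
      sub_eq_zero, ← hf]
    have h1 : θ f = c • (1 : ResidueField A) := by
      rw [← hc, Algebra.smul_def, mul_one]
      rfl
    rw [← θ.symm_apply_apply f, h1, map_smul]
    rfl

/-- The reduction of a dualizing module modulo a system of parameters `rs` is a faithful module over
`A ⧸ (rs)`: the length of `Ext^d(A ⧸ I, ω)` is that of `A ⧸ I` whenever `I` contains `rs`, and if
`a` annihilates the reduction of `ω`, then `I = (rs)` and `I = (rs, a)` give the same group. -/
lemma mem_ofList_of_smul_mem [IsNoetherianRing A] {rs : List A}
    (hmem : ∀ r ∈ rs, r ∈ maximalIdeal A)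
    (hA : IsWeaklyRegular A rs) {k : ℕ} (hk : maximalIdeal A ^ k ≤ Ideal.ofList rs)
    (hω : IsWeaklyRegular ω rs) (hinj : injectiveDimension (ModuleCat.of A ω) < ⊤)
    (htype : Nonempty (Ext (ModuleCat.of A (ResidueField A)) (ModuleCat.of A ω) rs.length
      ≃ₗ[A] ResidueField A)) {a : A}
    (ha : ∀ w : ω, a • w ∈ (Ideal.ofList rs • ⊤ : Submodule A ω)) : a ∈ Ideal.ofList rs := by
  obtain ⟨n, hn⟩ := (injectiveDimension_ne_top_iff _).mp hinj.ne
  have hlen : ∀ I, Ideal.ofList rs ≤ I →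
      Module.length A (CyclicExt rs.length I (ModuleCat.of A ω)) = Module.length A (A ⧸ I) := by
    refine colon_induction hk ?_ ?_ fun I a hI h₁ h₂ => ?_
    · have := subsingleton_cyclicExt_top rs.length (ModuleCat.of A ω)
      have : Subsingleton (A ⧸ (⊤ : Ideal A)) := Ideal.Quotient.subsingleton_iff.mpr rfl
      simp
    · obtain ⟨φ⟩ := htype
      exact φ.length_eq
    · have := subsingleton_cyclicExt_of_hasInjectiveDimensionLT hmem hA hk (ModuleCat.of A ω)
        (n + 1) (Nat.lt_succ_self _) (hI.trans (le_sup_left : I ≤ I ⊔ Ideal.span {a}))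
      rw [length_cyclicExt_eq_add (supInflate_injective hω hI a) colonRestrict_surjective, h₁, h₂,
        ← length_quotient_eq_add]
  have hann : ∀ r ∈ Ideal.ofList rs ⊔ Ideal.span {a},
      ∀ w : ω ⧸ (Ideal.ofList rs • ⊤ : Submodule A ω), r • w = 0 := by
    intro r hr w
    obtain ⟨w, rfl⟩ := Submodule.Quotient.mk_surjective _ w
    rw [← Submodule.Quotient.mk_smul, Submodule.Quotient.mk_eq_zero]
    obtain ⟨x, hx, y, hy, rfl⟩ := Submodule.mem_sup.mp hr
    obtain ⟨c, rfl⟩ := Ideal.mem_span_singleton'.mp hy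
    rw [add_smul, mul_smul]
    exact add_mem (Submodule.smul_mem_smul hx trivial) (Submodule.smul_mem _ c (ha w))
  have h₁ := hlen _ le_rfl
  have h₂ := hlen _ (le_sup_left : Ideal.ofList rs ≤ Ideal.ofList rs ⊔ Ideal.span {a})
  rw [length_cyclicExt_eq_length_cyclicHom hω le_rfl,
    length_cyclicHom_eq fun r hr => hann r (Ideal.mem_sup_left hr)] at h₁
  rw [length_cyclicExt_eq_length_cyclicHom hω le_sup_left, length_cyclicHom_eq hann] at h₂
  have h₃ := length_quotient_eq_add (Ideal.ofList rs) a
  rw [← h₁, ← h₂, eq_comm] at h₃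
  have hfin : Module.length A (A ⧸ Ideal.ofList rs) ≠ ⊤ := length_quotient_ne_top hk le_rfl
  rw [← h₁] at hfin
  have h₄ : Module.length A (A ⧸ (Ideal.ofList rs).colon {a}) = 0 := by
    refine le_antisymm ((ENat.add_le_add_iff_right hfin).mp ?_) zero_le
    rw [zero_add]
    exact h₃.le
  rw [Module.length_eq_zero_iff, Ideal.Quotient.subsingleton_iff] at h₄
  simpa using h₄

end Dualizing

/-! ### A criterion for finite injective dimension -/

/-- The local ring `R` has a regular sequence `rs` in its maximal ideal such that `R ⧸ (rs)` is
an Artinian ring whose socle is generated by one element, the class of `e`. -/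
def HasGorensteinReduction (R : Type*) [CommRing R] [IsLocalRing R] : Prop :=
  ∃ (rs : List R) (k : ℕ) (e : R), (∀ r ∈ rs, r ∈ maximalIdeal R) ∧ IsWeaklyRegular R rs ∧
    maximalIdeal R ^ k ≤ Ideal.ofList rs ∧ (∀ r ∈ maximalIdeal R, r * e ∈ Ideal.ofList rs) ∧
    ∀ b : R, (∀ r ∈ maximalIdeal R, r * b ∈ Ideal.ofList rs) → ∃ c : R, b - c * e ∈ Ideal.ofList rs

section Criterion

variable {R : Type u} [CommRing R] [IsLocalRing R] [IsNoetherianRing R]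

/-- Put `J = (rs)` and `d = rs.length`. By dévissage, the length of `Ext^d(R ⧸ I, R)` is at most
that of `R ⧸ I` for all `I` containing `J`, and for `I = J` the two agree because `Ext^d(R ⧸ J, R)`
is `R ⧸ J`. Hence they agree for all such `I`, the maps `Ext^d(R ⧸ I, R) → Ext^d(R ⧸ (I : a), R)`
are onto, and the vanishing of the higher `Ext` groups passes from `R ⧸ J` to all `R ⧸ I`, in
particular to the residue field. -/
theorem HasGorensteinReduction.injectiveDimension_lt_top (h : HasGorensteinReduction R) :
    injectiveDimension (ModuleCat.of R R) < ⊤ := by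
  obtain ⟨rs, k, e, hmem, hrs, hk, he, hsoc⟩ := h
  set J := Ideal.ofList rs with hJ
  let M := ModuleCat.of R R
  have hJtop : (J • ⊤ : Submodule R R) = J := by simp
  have hle : ∀ I, J ≤ I →
      Module.length R (CyclicExt rs.length I M) ≤ Module.length R (R ⧸ I) := by
    refine colon_induction hk ?_ ?_ fun I a _ h₁ h₂ => ?_
    · have := subsingleton_cyclicExt_top rs.length M
      simp
    · rw [length_cyclicExt_eq_length_cyclicHom (M := M) hrs (Ideal.span_le.mpr hmem)]
      refine length_cyclicHom_le (e := Submodule.Quotient.mk e) (fun r hr => ?_) fun w hw => ?_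
      · rw [← Submodule.Quotient.mk_smul, Submodule.Quotient.mk_eq_zero]
        exact hJtop ▸ he r hr
      · obtain ⟨b, rfl⟩ := Submodule.Quotient.mk_surjective _ w
        obtain ⟨c, hc⟩ := hsoc b fun r hr => by
          have := hw r hr
          rw [← Submodule.Quotient.mk_smul, Submodule.Quotient.mk_eq_zero] at this
          exact hJtop ▸ this
        refine ⟨c, ?_⟩
        rw [← sub_eq_zero, ← Submodule.Quotient.mk_smul, ← Submodule.Quotient.mk_sub,
          Submodule.Quotient.mk_eq_zero]
        exact hJtop ▸ hc
    · refine (length_cyclicExt_le (a := a)).trans ?_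
      rw [length_quotient_eq_add I a]
      exact add_le_add h₂ h₁
  have hfin : ∀ I, J ≤ I → Module.length R (R ⧸ I) ≠ ⊤ := fun I hI => length_quotient_ne_top hk hI
  have hsurj : ∀ (K : Ideal R) (a : R), J ≤ K →
      Module.length R (CyclicExt rs.length K M) = Module.length R (R ⧸ K) →
      Function.Surjective (colonRestrict rs.length K a M) := by
    intro K a hK hlen
    have h₁ := hle _ (hK.trans (le_sup_left : K ≤ K ⊔ Ideal.span {a}))
    have h₂ := hle _ (hK.trans (le_colon_singleton K a))
    refine colonRestrict_surjective_of_length_le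
      (ne_top_of_le_ne_top (hfin _ (hK.trans (le_colon_singleton K a))) h₂)
      (ne_top_of_le_ne_top (hfin _ (hK.trans le_sup_left)) h₁) ?_
    rw [hlen, length_quotient_eq_add K a]
    exact add_le_add h₂ h₁
  have hfirst : ∀ I, J ≤ I → Module.length R (CyclicExt rs.length I M) = Module.length R (R ⧸ I) ∧
      Subsingleton (CyclicExt (rs.length + 1) I M) := by
    refine sup_induction ⟨?_, subsingleton_cyclicExt_ofList hmem hrs M (Nat.lt_succ_self _)⟩
      fun K a hK hP => ⟨le_antisymm (hle _ (hK.trans le_sup_left)) ?_,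
        subsingleton_cyclicExt_sup (hsurj K a hK hP.1) hP.2⟩
    · rw [length_cyclicExt_eq_length_cyclicHom (M := M) hrs le_rfl, length_cyclicHom_eq]
      · exact (Submodule.quotEquivOfEq _ _ hJtop).length_eq
      · intro r hr w
        obtain ⟨b, rfl⟩ := Submodule.Quotient.mk_surjective _ w
        rw [← Submodule.Quotient.mk_smul, Submodule.Quotient.mk_eq_zero]
        exact Submodule.smul_mem_smul hr trivial
    · have h₁ := hle _ (hK.trans (le_colon_singleton K a))
      have h₂ := length_cyclicExt_le (n := rs.length) (I := K) (a := a) (M := M)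
      rw [hP.1, length_quotient_eq_add K a] at h₂
      exact (ENat.add_le_add_iff_left (hfin _ (hK.trans (le_colon_singleton K a)))).mp
        (h₂.trans (add_le_add_left h₁ _))
  have hall : ∀ i, ∀ I, J ≤ I → Subsingleton (CyclicExt (rs.length + 1 + i) I M) := by
    intro i
    induction i with
    | zero => exact fun I hI => (hfirst I hI).2
    | succ i ih =>
      refine sup_induction (subsingleton_cyclicExt_ofList hmem hrs M (by omega))
        fun K a hK hP => ?_
      have := ih _ (hK.trans (le_colon_singleton K a))
      exact subsingleton_cyclicExt_sup (fun x => ⟨0, Subsingleton.elim _ _⟩) hP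
  have : HasInjectiveDimensionLE M rs.length :=
    hasInjectiveDimensionLE_of_subsingleton_cyclicExt
      (subsingleton_cyclicExt_of_maximalIdeal fun i hi => by
        obtain ⟨j, rfl⟩ := Nat.exists_eq_add_of_lt hi
        have := hall j _ (Ideal.span_le.mpr hmem)
        rwa [show rs.length + j + 1 = rs.length + 1 + j by omega])
  exact lt_top_iff_ne_top.mpr ((injectiveDimension_ne_top_iff _).mpr ⟨_, this⟩)

lemma injectiveDimension_self_congr {R S : Type*} [CommRing R] [CommRing S] (e : R ≃+* S) :
    injectiveDimension (ModuleCat.of R R) = injectiveDimension (ModuleCat.of S S) :=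
  letI := RingHomInvPair.of_ringEquiv e
  letI := RingHomInvPair.of_ringEquiv e.symm
  ModuleCat.injectiveDimension_eq_of_semiLinearEquiv (M := ModuleCat.of R R)
    (N := ModuleCat.of S S) e e.toSemilinearEquiv

end Criterion

/-! ### Regular sequences and depth -/

section Depth

/-- A finite depth is attained. The sequence is only claimed to be weakly regular, since the depth
of the zero module is `0` as well. -/
lemma exists_isWeaklyRegular_of_depth_eq {A : Type*} [CommRing A] [IsLocalRing A] {M : Type*}
    [AddCommGroup M] [Module A M] {d : ℕ} (h : depth A M = d) :
    ∃ rs : List A, rs.length = d ∧ (∀ r ∈ rs, r ∈ maximalIdeal A) ∧ IsWeaklyRegular M rs := by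
  rcases d with _ | d
  · exact ⟨[], rfl, by simp, IsWeaklyRegular.nil A M⟩
  have hlt : (d : ℕ∞) < depth A M := by
    rw [h]
    exact_mod_cast Nat.lt_succ_self d
  obtain ⟨rs, hlt⟩ := lt_iSup_iff.mp hlt
  obtain ⟨⟨hmem, hreg⟩, hlt⟩ := lt_iSup_iff.mp hlt
  have hd : d < rs.length := by exact_mod_cast hlt
  refine ⟨rs.take (d + 1), by simpa using hd, fun r hr => hmem r (List.mem_of_mem_take hr), ?_⟩
  have := hreg.toIsWeaklyRegular
  rw [← List.take_append_drop (d + 1) rs, isWeaklyRegular_append_iff] at this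
  exact this.1

lemma exists_maximalIdeal_pow_le {A : Type*} [CommRing A] [IsLocalRing A] [IsNoetherianRing A]
    {rs : List A} (hmem : ∀ r ∈ rs, r ∈ maximalIdeal A) (hrs : IsWeaklyRegular A rs)
    (hdim : ringKrullDim A = (rs.length : WithBot ℕ∞)) :
    ∃ k, maximalIdeal A ^ k ≤ Ideal.ofList rs := by
  have hreg : IsRegular A rs := IsRegular.of_isWeaklyRegular_of_mem_maximalIdeal A hmem hrs
  have h := ringKrullDim_add_length_eq_ringKrullDim_of_isRegular rs hreg
  have h0 : ringKrullDim (A ⧸ Ideal.ofList rs) ≤ 0 := by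
    rw [← ENat.WithBot.add_le_add_natCast_right_iff (c := rs.length), h, hdim, zero_add]
  have hzero : Ring.KrullDimLE 0 (A ⧸ Ideal.ofList rs) :=
    Ring.krullDimLE_iff.mpr (by simpa using h0)
  have hne : Ideal.ofList rs ≠ ⊤ := fun h =>
    (maximalIdeal.isMaximal A).ne_top (top_le_iff.mp (h ▸ Ideal.span_le.mpr hmem))
  have : Nontrivial (A ⧸ Ideal.ofList rs) := Ideal.Quotient.nontrivial_iff.mpr hne
  have : IsLocalRing (A ⧸ Ideal.ofList rs) :=
    IsLocalRing.of_surjective' _ (Ideal.Quotient.mk_surjective (I := Ideal.ofList rs))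
  obtain ⟨k, hk⟩ := (isArtinianRing_iff_isNilpotent_maximalIdeal (A ⧸ Ideal.ofList rs)).mp
    (isArtinianRing_iff_isNoetherianRing_krullDimLE_zero.mpr ⟨inferInstance, hzero⟩)
  refine ⟨k, ?_⟩
  rw [← Ideal.mk_ker (I := Ideal.ofList rs), RingHom.ker_eq_comap_bot, ← Ideal.map_le_iff_le_comap,
    Ideal.map_pow, ← Ideal.zero_eq_bot, ← hk]
  refine Ideal.pow_right_mono (Ideal.map_le_iff_le_comap.mpr fun x hx => ?_) k
  have := IsLocalHom.of_surjective (Ideal.Quotient.mk (Ideal.ofList rs))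
    (Ideal.Quotient.mk_surjective (I := Ideal.ofList rs))
  exact map_nonunit _ x hx

/-- Finitely many modules of depth at least `d` have a common weakly regular sequence of
length `d`. -/
lemma exists_common_isWeaklyRegular {R : Type u} [CommRing R] [IsLocalRing R] [IsNoetherianRing R]
    {ι : Type*} [Finite ι] (M : ι → ModuleCat.{u} R) [∀ i, Module.Finite R (M i)] {d : ℕ}
    (h : ∀ i, ∀ j < d, Subsingleton (CyclicExt j (maximalIdeal R) (M i))) :
    ∃ rs : List R, rs.length = d ∧ (∀ r ∈ rs, r ∈ maximalIdeal R) ∧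
      ∀ i, IsWeaklyRegular (M i) rs := by
  induction d generalizing M with
  | zero => exact ⟨[], rfl, by simp, fun i => IsWeaklyRegular.nil R (M i)⟩
  | succ d ih =>
    have hhom : Subsingleton ((R ⧸ maximalIdeal R) →ₗ[R] (∀ i, M i)) := by
      refine subsingleton_of_forall_eq 0 fun f => LinearMap.ext fun x => funext fun i => ?_
      have := h i 0 d.succ_pos
      have hi : Subsingleton ((R ⧸ maximalIdeal R) →ₗ[R] M i) :=
        ((Ext.addEquiv₀ (X := ModuleCat.of R (R ⧸ maximalIdeal R)) (Y := M i)).trans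
          ModuleCat.homAddEquiv).symm.subsingleton
      exact LinearMap.congr_fun (Subsingleton.elim ((LinearMap.proj i).comp f) 0) x
    obtain ⟨r, hr, hreg⟩ := IsSMulRegular.subsingleton_linearMap_iff.mp hhom
    rw [Ideal.annihilator_quotient] at hr
    have hregi : ∀ i, IsSMulRegular (M i) r := fun i => by
      classical
      exact hreg.of_injective (LinearMap.single R (fun i => M i) i) 
        fun _ _ h => Pi.single_injective i h
    obtain ⟨rs, hlen, hmem, hrs⟩ := ih
        (fun i => ModuleCat.of R (QuotSMulTop r (M i))) fun i j hj => by
      refine subsingleton_of_forall_eq 0 fun x => ?_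
      have := h i j (by omega)
      have := h i (j + 1) (by omega)
      obtain ⟨y, rfl⟩ := Ext.covariant_sequence_exact₃ _ (hregi i).smulShortComplex_shortExact x rfl
        (Subsingleton.elim (α := CyclicExt (j + 1) (maximalIdeal R) (M i)) _ _)
      have hy : y = 0 := Subsingleton.elim (α := CyclicExt j (maximalIdeal R) (M i)) y 0
      rw [hy, Ext.zero_comp]
      rfl
    refine ⟨r :: rs, by simpa using hlen, by simpa using ⟨hr, hmem⟩, fun i => ?_⟩
    exact (isWeaklyRegular_cons_iff _ _ _).mpr ⟨hregi i, hrs i⟩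

end Depth

/-! ### Ideals and regular sequences in a double extension -/

namespace DoubleExtension

section Basic

variable {A₁ A₂ M₁ M₂ B : Type*} [CommRing A₁] [CommRing A₂] [CommRing B]
  [AddCommGroup M₁] [Module A₁ M₁] [AddCommGroup M₂] [Module A₂ M₂]

/-- The double extension with the roles of `A₁` and `A₂` exchanged. -/
def swap (E : DoubleExtension A₁ A₂ M₁ M₂ B) : DoubleExtension A₂ A₁ M₂ M₁ B where
  i₁ := E.i₂
  i₂ := E.i₁
  p₁ := E.p₂
  p₂ := E.p₁
  injective_i₁ := E.injective_i₂
  injective_i₂ := E.injective_i₁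
  exact₁ := E.exact₂
  exact₂ := E.exact₁
  surjective_p₁ := E.surjective_p₂
  surjective_p₂ := E.surjective_p₁
  mul_i₁ := E.mul_i₂
  mul_i₂ := E.mul_i₁

variable (E : DoubleExtension A₁ A₂ M₁ M₂ B)

/-- The module `M₁`, identified with the ideal `ker p₂` of `B`. -/
noncomputable def kerEquiv : M₁ ≃+ RingHom.ker E.p₂ :=
  AddEquiv.ofBijective
    (E.i₁.codRestrict (RingHom.ker E.p₂).toAddSubgroup fun x => E.exact₂.apply_apply_eq_zero x)
    ⟨fun _ _ h => E.injective_i₁ (congrArg Subtype.val h), fun y =>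
      let ⟨x, hx⟩ := (E.exact₂ y.1).mp y.2
      ⟨x, Subtype.ext hx⟩⟩

lemma coe_kerEquiv (x : M₁) : (E.kerEquiv x : B) = E.i₁ x := rfl

lemma kerEquiv_smul (b : B) (x : M₁) : E.kerEquiv (E.p₁ b • x) = b • E.kerEquiv x :=
  Subtype.ext (E.mul_i₁ b x).symm

/-- The product of the two ideals vanishes: `i₁ x * i₂ y = i₂ (p₂ (i₁ x) • y)` and
`p₂ (i₁ x) = 0`. -/
lemma ker_mul_ker : RingHom.ker E.p₁ * RingHom.ker E.p₂ = ⊥ := by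
  rw [eq_bot_iff, Ideal.mul_le]
  intro r hr s hs
  obtain ⟨x, rfl⟩ := (E.exact₁ r).mp hr
  rw [Ideal.mem_bot, mul_comm, E.mul_i₂, (RingHom.mem_ker).mp hs, zero_smul, map_zero]

lemma isNoetherianRing (E : DoubleExtension A₁ A₂ M₁ M₂ B) [IsNoetherianRing A₁]
    [IsNoetherianRing A₂] [Module.Finite A₁ M₁] : IsNoetherianRing B := by
  rw [isNoetherianRing_iff, isNoetherian_iff_submodule_quotient (RingHom.ker E.p₂)]
  have : RingHomSurjective E.p₁ := ⟨E.surjective_p₁⟩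
  have : RingHomSurjective E.p₂ := ⟨E.surjective_p₂⟩
  constructor
  · let l : RingHom.ker E.p₂ →ₛₗ[E.p₁] M₁ :=
      { E.kerEquiv.symm with
        map_smul' := fun b x => by
          apply E.kerEquiv.injective
          change E.kerEquiv (E.kerEquiv.symm (b • x)) = E.kerEquiv (E.p₁ b • E.kerEquiv.symm x)
          rw [kerEquiv_smul, AddEquiv.apply_symm_apply, AddEquiv.apply_symm_apply] }
    exact (LinearMap.isNoetherian_iff_of_bijective l E.kerEquiv.symm.bijective).mpr inferInstance
  · let e := RingHom.quotientKerEquivOfSurjective E.surjective_p₂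
    let l : (B ⧸ RingHom.ker E.p₂) →ₛₗ[E.p₂] A₂ :=
      { toFun := e
        map_add' := map_add e
        map_smul' := fun b x => by
          rw [Algebra.smul_def, map_mul]
          rfl }
    exact (LinearMap.isNoetherian_iff_of_bijective l e.bijective).mpr inferInstance

lemma isWeaklyRegular_ker_iff (rs : List B) :
    IsWeaklyRegular M₁ (rs.map E.p₁) ↔ IsWeaklyRegular (RingHom.ker E.p₂) rs :=
  E.kerEquiv.isWeaklyRegular_congr <| List.forall₂_map_left_iff.mpr <|
    List.forall₂_same.mpr fun b _ x => E.kerEquiv_smul b x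

lemma isWeaklyRegular_quotient_iff (rs : List B) :
    IsWeaklyRegular (B ⧸ RingHom.ker E.p₁) rs ↔ IsWeaklyRegular A₁ (rs.map E.p₁) :=
  (RingHom.quotientKerEquivOfSurjective E.surjective_p₁).toAddEquiv.isWeaklyRegular_congr <|
    List.forall₂_map_right_iff.mpr <| List.forall₂_same.mpr fun b _ x => by
      change RingHom.quotientKerEquivOfSurjective E.surjective_p₁ (b • x) = _
      rw [Algebra.smul_def, map_mul]
      rfl

lemma i₁_mem_ofList {rs : List B} {x : M₁}
    (hx : x ∈ (Ideal.ofList (rs.map E.p₁) • ⊤ : Submodule A₁ M₁)) : E.i₁ x ∈ Ideal.ofList rs := by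
  refine Submodule.smul_induction_on hx (fun r hr y _ => ?_) fun x y hx hy => ?_
  · rw [← Ideal.map_ofList, Ideal.mem_map_iff_of_surjective _ E.surjective_p₁] at hr
    obtain ⟨j, hj, rfl⟩ := hr
    rw [← E.mul_i₁]
    exact Ideal.mul_mem_right _ _ hj
  · rw [map_add]
    exact add_mem hx hy

/-- Since `rs` is regular on `B ⧸ ker p₂`, the intersection of `(rs)` with `ker p₂ = i₁(M₁)` is
`(rs) • i₁(M₁)`. -/
lemma mem_smul_top_of_i₁_mem {rs : List B} (hrs : IsWeaklyRegular (B ⧸ RingHom.ker E.p₂) rs)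
    {x : M₁} (hx : E.i₁ x ∈ Ideal.ofList rs) :
    x ∈ (Ideal.ofList (rs.map E.p₁) • ⊤ : Submodule A₁ M₁) := by
  set I := RingHom.ker E.p₂
  have h := map_first_exact_on_four_term_right_exact_of_isSMulRegular_last (rs := rs)
    (f₁ := (0 : PUnit →ₗ[B] I)) (f₂ := I.subtype) (f₃ := I.mkQ)
    (fun y => by simp [eq_comm]) (LinearMap.exact_subtype_mkQ I) (Submodule.mkQ_surjective I) hrs
  have hmem : E.kerEquiv x ∈ (Ideal.ofList rs • ⊤ : Submodule B I) := by
    rw [← Submodule.Quotient.mk_eq_zero]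
    obtain ⟨z, hz⟩ := (h (Submodule.Quotient.mk (E.kerEquiv x))).mp <| by
      rw [Submodule.mapQ_apply, Submodule.Quotient.mk_eq_zero]
      simpa only [Ideal.smul_top_eq_map, Submodule.subtype_apply, Algebra.algebraMap_self,
        Ideal.map_id, Submodule.restrictScalars_self, coe_kerEquiv] using hx
    obtain ⟨z, rfl⟩ := Submodule.Quotient.mk_surjective _ z
    rw [← hz, Submodule.mapQ_apply]
    simp
  rw [← E.kerEquiv.symm_apply_apply x]
  refine Submodule.smul_induction_on hmem (fun r hr y _ => ?_) fun x y hx hy => ?_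
  · have : E.kerEquiv.symm (r • y) = E.p₁ r • E.kerEquiv.symm y := by
      apply E.kerEquiv.injective
      rw [kerEquiv_smul, AddEquiv.apply_symm_apply, AddEquiv.apply_symm_apply]
    rw [this]
    refine Submodule.smul_mem_smul ?_ trivial
    rw [← Ideal.map_ofList]
    exact Ideal.mem_map_of_mem _ hr
  · rw [map_add]
    exact add_mem hx hy

lemma eq_comap_maximalIdeal [IsLocalRing A₁] {P : Ideal B} (hP : P.IsMaximal)
    (hle : RingHom.ker E.p₁ ≤ P) : P = (maximalIdeal A₁).comap E.p₁ := by
  refine hP.eq_of_le (Ideal.comap_ne_top _ (maximalIdeal.isMaximal A₁).ne_top) fun b hb => ?_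
  rw [Ideal.mem_comap, mem_maximalIdeal]
  intro hu
  obtain ⟨c, hc⟩ := hu.exists_right_inv
  obtain ⟨c, rfl⟩ := E.surjective_p₁ c
  have h1 : b * c - 1 ∈ P := hle (by rw [RingHom.mem_ker, map_sub, map_mul, hc, map_one, sub_self])
  refine hP.ne_top ((Ideal.eq_top_iff_one P).mpr ?_)
  have := P.sub_mem (P.mul_mem_right c hb) h1
  simpa using this

lemma ker_le_or_ker_le {P : Ideal B} (hP : P.IsPrime) :
    RingHom.ker E.p₁ ≤ P ∨ RingHom.ker E.p₂ ≤ P :=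
  hP.mul_le.mp (E.ker_mul_ker ▸ bot_le)

end Basic

/-! ### The case of two maximal ideals -/

section Disconnected

variable {A₁ A₂ M₁ M₂ B : Type*} [CommRing A₁] [CommRing A₂] [CommRing B]
  [AddCommGroup M₁] [Module A₁ M₁] [AddCommGroup M₂] [Module A₂ M₂]
  (E : DoubleExtension A₁ A₂ M₁ M₂ B) [IsLocalRing A₁] {P : Ideal B}

/-- If `ker p₂` is not contained in the maximal ideal `P`, then localizing at `P` kills
`ker p₁`, since `ker p₁ * ker p₂ = 0`. -/
lemma isLocalization_atPrime [hP : P.IsMaximal] (h : ¬ RingHom.ker E.p₂ ≤ P) :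
    let _ := E.p₁.toAlgebra
    IsLocalization.AtPrime A₁ P := by
  let _ := E.p₁.toAlgebra
  have hle := (E.ker_le_or_ker_le hP.isPrime).resolve_right h
  have hPeq := E.eq_comap_maximalIdeal hP hle
  obtain ⟨c, hc, hcP⟩ := SetLike.not_le_iff_exists.mp h
  refine (isLocalization_iff _ _).mpr ⟨fun b => ?_, fun a => ?_, fun {b b'} hbb => ?_⟩
  · by_contra hu
    exact b.2 (hPeq ▸ (mem_maximalIdeal _).mpr hu)
  · obtain ⟨b, rfl⟩ := E.surjective_p₁ a
    exact ⟨(b, 1), by simp [RingHom.algebraMap_toAlgebra]⟩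
  · refine ⟨⟨c, hcP⟩, ?_⟩
    have hmem : b - b' ∈ RingHom.ker E.p₁ := by
      rw [RingHom.mem_ker, map_sub, sub_eq_zero]
      exact hbb
    have h0 : (b - b') * c ∈ RingHom.ker E.p₁ * RingHom.ker E.p₂ := Ideal.mul_mem_mul hmem hc
    rw [E.ker_mul_ker, Ideal.mem_bot, sub_mul, sub_eq_zero] at h0
    simpa [mul_comm] using h0

/-- If `ker p₂` is not contained in the maximal ideal `P`, then `M₁` is free of rank one: any `y`
with `i₁ y` outside `P` is a basis. -/
lemma nonempty_linearEquiv [hP : P.IsMaximal] (h : ¬ RingHom.ker E.p₂ ≤ P) :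
    Nonempty (A₁ ≃ₗ[A₁] M₁) := by
  have hPeq := E.eq_comap_maximalIdeal hP ((E.ker_le_or_ker_le hP.isPrime).resolve_right h)
  obtain ⟨c, hc, hcP⟩ := SetLike.not_le_iff_exists.mp h
  obtain ⟨y, rfl⟩ := (E.exact₂ c).mp hc
  have hu : IsUnit (E.p₁ (E.i₁ y)) := by
    by_contra hu
    exact hcP (hPeq ▸ (mem_maximalIdeal _).mpr hu)
  refine ⟨LinearEquiv.ofBijective (LinearMap.toSpanSingleton A₁ M₁ y) ⟨?_, fun x => ?_⟩⟩
  · rw [injective_iff_map_eq_zero]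
    intro a ha
    obtain ⟨b, rfl⟩ := E.surjective_p₁ a
    rw [LinearMap.toSpanSingleton_apply] at ha
    have : b * E.i₁ y = 0 := by rw [E.mul_i₁, ha, map_zero]
    have := congrArg E.p₁ this
    rw [map_mul, map_zero] at this
    exact hu.mul_left_eq_zero.mp this
  · obtain ⟨a, ha⟩ := hu.exists_left_inv
    refine ⟨a * E.p₁ (E.i₁ x), ?_⟩
    have hxy : E.p₁ (E.i₁ x) • y = E.p₁ (E.i₁ y) • x := by
      apply E.injective_i₁
      rw [← E.mul_i₁, ← E.mul_i₁, mul_comm]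
    rw [LinearMap.toSpanSingleton_apply, mul_smul, hxy, ← mul_smul, ha, one_smul]

end Disconnected

end DoubleExtension

/-! ### Dualizing modules and double extensions -/

section DualizingModule

variable {A : Type*} [CommRing A] [IsLocalRing A]

lemma exists_ringKrullDim_eq [IsNoetherianRing A] : ∃ d : ℕ, ringKrullDim A = (d : WithBot ℕ∞) := by
  have hbot : ringKrullDim A ≠ ⊥ := ringKrullDim_ne_bot
  have htop : ringKrullDim A ≠ ⊤ := ringKrullDim_ne_top
  generalize ringKrullDim A = n at hbot htop
  induction n with
  | bot => exact absurd rfl hbot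
  | coe n =>
    induction n with
    | top => exact absurd rfl htop
    | coe d => exact ⟨d, rfl⟩

lemma exists_isWeaklyRegular_of_depth_eq_ringKrullDim {M : Type*} [AddCommGroup M] [Module A M]
    {d : ℕ} (hd : ringKrullDim A = (d : WithBot ℕ∞))
    (h : (depth A M : WithBot ℕ∞) = ringKrullDim A) :
    ∃ rs : List A, rs.length = d ∧ (∀ r ∈ rs, r ∈ maximalIdeal A) ∧ IsWeaklyRegular M rs :=
  exists_isWeaklyRegular_of_depth_eq (WithBot.coe_inj.mp (h.trans hd))

end DualizingModule

/-- A Cohen-Macaulay local ring that is its own dualizing module has a quotient by a regular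
sequence which is Artinian with simple socle. -/
lemma IsDualizingModule.hasGorensteinReduction {A : Type v} [CommRing A] [IsLocalRing A]
    {ω : Type v} [AddCommGroup ω] [Module A ω] (hω : IsDualizingModule A ω)
    (hA : IsCohenMacaulayLocalRing A) (φ : A ≃ₗ[A] ω) : HasGorensteinReduction A := by
  have := hA.isNoetherianRing
  obtain ⟨d, hd⟩ := exists_ringKrullDim_eq (A := A)
  obtain ⟨rs, rfl, hmem, hrs⟩ := exists_isWeaklyRegular_of_depth_eq_ringKrullDim hd hA.depth_eq
  obtain ⟨k, hk⟩ := exists_maximalIdeal_pow_le hmem hrs hd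
  obtain ⟨e, -, he, hsoc⟩ := exists_socle_generator ((φ.isWeaklyRegular_congr rs).mp hrs) hmem
    (hω.type_eq_one _ hd)
  have hφ : ∀ x : A, φ x ∈ (Ideal.ofList rs • ⊤ : Submodule A ω) ↔ x ∈ Ideal.ofList rs := by
    intro x
    have : (Ideal.ofList rs • ⊤ : Submodule A ω) =
        (Ideal.ofList rs • (⊤ : Submodule A A)).map φ.toLinearMap := by
      rw [Submodule.map_smul'', Submodule.map_top, LinearEquiv.range]
    rw [this]
    simp
  refine ⟨rs, k, φ.symm e, hmem, hrs, hk, fun r hr => ?_, fun b hb => ?_⟩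
  · rw [← hφ, ← smul_eq_mul, map_smul, φ.apply_symm_apply]
    exact he r hr
  · obtain ⟨c, hc⟩ := hsoc (φ b) fun r hr => by
      rw [← map_smul, hφ]
      exact hb r hr
    refine ⟨c, (hφ _).mp ?_⟩
    rw [← smul_eq_mul, map_sub, map_smul, φ.apply_symm_apply]
    exact hc

lemma maximalIdeal_pow_le_sup_ker {B C : Type*} [CommRing B] [IsLocalRing B] [CommRing C]
    [IsLocalRing C] {p : B →+* C} (hp : Function.Surjective p)
    (hloc : ∀ b ∈ maximalIdeal B, p b ∈ maximalIdeal C) {rs : List B} {k : ℕ}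
    (hk : maximalIdeal C ^ k ≤ Ideal.ofList (rs.map p)) :
    maximalIdeal B ^ k ≤ Ideal.ofList rs ⊔ RingHom.ker p := by
  rw [← Ideal.comap_map_of_surjective' p hp, Ideal.map_ofList, ← Ideal.map_le_iff_le_comap,
    Ideal.map_pow]
  exact (Ideal.pow_right_mono (Ideal.map_le_iff_le_comap.mpr hloc) k).trans hk

/-! ### The case of one maximal ideal -/

section LocalCase

variable {A₁ : Type u₁} [CommRing A₁] [IsLocalRing A₁] {A₂ : Type u₂} [CommRing A₂]
  {ω₁ : Type u₁} [AddCommGroup ω₁] [Module A₁ ω₁] {ω₂ : Type u₂} [AddCommGroup ω₂] [Module A₂ ω₂]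
  {B : Type v} [CommRing B] [IsLocalRing B]

lemma DoubleExtension.map_mem_maximalIdeal_iff (E : DoubleExtension A₁ A₂ ω₁ ω₂ B) (b : B) :
    E.p₁ b ∈ maximalIdeal A₁ ↔ b ∈ maximalIdeal B := by
  rw [E.eq_comap_maximalIdeal (maximalIdeal.isMaximal B)
    (le_maximalIdeal (RingHom.ker_ne_top E.p₁)), Ideal.mem_comap]

/-- The groups `Ext^j(k, -)` over the local double extension `B` vanish for `j < dim A₁` on the
modules `M₁` and `A₁`. -/
lemma DoubleExtension.subsingleton_cyclicExt (E : DoubleExtension A₁ A₂ ω₁ ω₂ B)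
    (hA : IsCohenMacaulayLocalRing A₁) (hω : IsDualizingModule A₁ ω₁) {d : ℕ}
    (hd : ringKrullDim A₁ = (d : WithBot ℕ∞)) {j : ℕ} (hj : j < d) :
    Subsingleton (CyclicExt j (maximalIdeal B) (ModuleCat.of B (RingHom.ker E.p₂))) ∧
      Subsingleton (CyclicExt j (maximalIdeal B) (ModuleCat.of B (B ⧸ RingHom.ker E.p₁))) := by
  have hlift : ∀ as : List A₁, (∀ r ∈ as, r ∈ maximalIdeal A₁) →
      ∃ bs : List B, bs.map E.p₁ = as ∧ ∀ b ∈ bs, b ∈ maximalIdeal B := by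
    intro as has
    obtain ⟨bs, rfl⟩ := List.map_surjective_iff.mpr E.surjective_p₁ as
    exact ⟨bs, rfl, fun b hb =>
      (E.map_mem_maximalIdeal_iff b).mp (has _ (List.mem_map_of_mem hb))⟩
  constructor
  · obtain ⟨as, hlen, has, hreg⟩ := exists_isWeaklyRegular_of_depth_eq_ringKrullDim hd hω.depth_eq
    obtain ⟨bs, rfl, hbs⟩ := hlift as has
    rw [E.isWeaklyRegular_ker_iff] at hreg
    exact subsingleton_ext_of_isWeaklyRegular (M := ModuleCat.of B (RingHom.ker E.p₂)) hreg
      (mem_annihilator_of_le (Ideal.span_le.mpr hbs)) (by rw [List.length_map] at hlen; omega)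
  · obtain ⟨as, hlen, has, hreg⟩ := exists_isWeaklyRegular_of_depth_eq_ringKrullDim hd hA.depth_eq
    obtain ⟨bs, rfl, hbs⟩ := hlift as has
    rw [← E.isWeaklyRegular_quotient_iff] at hreg
    exact subsingleton_ext_of_isWeaklyRegular (M := ModuleCat.of B (B ⧸ RingHom.ker E.p₁)) hreg
      (mem_annihilator_of_le (Ideal.span_le.mpr hbs)) (by rw [List.length_map] at hlen; omega)

/-- A regular sequence of `B` that is regular on `A₁`, `A₂`, `ω₁` and `ω₂`. -/
lemma DoubleExtension.exists_common_isWeaklyRegular [IsLocalRing A₂]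
    (E : DoubleExtension A₁ A₂ ω₁ ω₂ B)
    (hA₁ : IsCohenMacaulayLocalRing A₁) (hA₂ : IsCohenMacaulayLocalRing A₂)
    (hω₁ : IsDualizingModule A₁ ω₁) (hω₂ : IsDualizingModule A₂ ω₂) [IsNoetherianRing B] {d : ℕ}
    (hd₁ : ringKrullDim A₁ = (d : WithBot ℕ∞)) (hd₂ : ringKrullDim A₂ = (d : WithBot ℕ∞)) :
    ∃ rs : List B, rs.length = d ∧ (∀ r ∈ rs, r ∈ maximalIdeal B) ∧ IsWeaklyRegular B rs ∧
      IsWeaklyRegular (RingHom.ker E.p₁) rs ∧ IsWeaklyRegular (RingHom.ker E.p₂) rs ∧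
      IsWeaklyRegular (B ⧸ RingHom.ker E.p₁) rs ∧ IsWeaklyRegular (B ⧸ RingHom.ker E.p₂) rs := by
  let M : Fin 5 → ModuleCat.{v} B := ![ModuleCat.of B B, ModuleCat.of B (RingHom.ker E.p₁),
    ModuleCat.of B (RingHom.ker E.p₂), ModuleCat.of B (B ⧸ RingHom.ker E.p₁),
    ModuleCat.of B (B ⧸ RingHom.ker E.p₂)]
  have hfin : ∀ i, Module.Finite B (M i) := by
    intro i
    fin_cases i
    · exact inferInstanceAs (Module.Finite B B)
    · exact inferInstanceAs (Module.Finite B (RingHom.ker E.p₁))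
    · exact inferInstanceAs (Module.Finite B (RingHom.ker E.p₂))
    · exact inferInstanceAs (Module.Finite B (B ⧸ RingHom.ker E.p₁))
    · exact inferInstanceAs (Module.Finite B (B ⧸ RingHom.ker E.p₂))
  obtain ⟨rs, hlen, hmem, hrs⟩ := LinkageExtension.exists_common_isWeaklyRegular M (d := d) (by
    intro i j hj
    obtain ⟨h₁, h₂⟩ := E.subsingleton_cyclicExt hA₁ hω₁ hd₁ hj
    have h₃ : Subsingleton
        (CyclicExt j (maximalIdeal B) (ModuleCat.of B (RingHom.ker E.p₁))) :=
      (E.swap.subsingleton_cyclicExt hA₂ hω₂ hd₂ hj).1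
    have h₄ := (E.swap.subsingleton_cyclicExt hA₂ hω₂ hd₂ hj).2
    fin_cases i
    · have hS : (ModuleCat.shortComplexOfCompEqZero (RingHom.ker E.p₁).subtype
          (RingHom.ker E.p₁).mkQ
          (LinearMap.exact_subtype_mkQ (RingHom.ker E.p₁)).linearMap_comp_eq_zero).ShortExact :=
        ModuleCat.shortComplex_shortExact _ (LinearMap.exact_subtype_mkQ _)
          (Submodule.subtype_injective _) (Submodule.mkQ_surjective _)
      refine subsingleton_of_forall_eq 0 fun x => ?_
      obtain ⟨y, rfl⟩ := Ext.covariant_sequence_exact₂ _ hS x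
        (Subsingleton.elim (α := CyclicExt j (maximalIdeal B)
          (ModuleCat.of B (B ⧸ RingHom.ker E.p₁))) _ _)
      have hy : y = 0 := Subsingleton.elim
        (α := CyclicExt j (maximalIdeal B) (ModuleCat.of B (RingHom.ker E.p₁))) y 0
      rw [hy, Ext.zero_comp]
      rfl
    · exact h₃
    · exact h₁
    · exact h₂
    · exact h₄)
  exact ⟨rs, hlen, hmem, hrs 0, hrs 1, hrs 2, hrs 3, hrs 4⟩

/-- The socle of `B ⧸ (rs)`: an element `b` of the socle annihilates `ω₁ ⧸ (rs) ω₁`, which is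
faithful over `A₁ ⧸ (rs)`; hence `b` comes from `ω₂`, and lies in the simple socle of
`ω₂ ⧸ (rs) ω₂`. -/
lemma DoubleExtension.hasGorensteinReduction [IsLocalRing A₂]
    (E : DoubleExtension A₁ A₂ ω₁ ω₂ B)
    (hA₁ : IsCohenMacaulayLocalRing A₁) (hA₂ : IsCohenMacaulayLocalRing A₂)
    (hω₁ : IsDualizingModule A₁ ω₁) (hω₂ : IsDualizingModule A₂ ω₂)
    (hdim : ringKrullDim A₁ = ringKrullDim A₂) : HasGorensteinReduction B := by
  have := hA₁.isNoetherianRing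
  have := hA₂.isNoetherianRing
  have := hω₁.finite
  have := E.isNoetherianRing
  obtain ⟨d, hd₁⟩ := exists_ringKrullDim_eq (A := A₁)
  have hd₂ := hdim.symm.trans hd₁
  obtain ⟨rs, rfl, hmem, hB, hK₁, hK₂, hQ₁, hQ₂⟩ :=
    E.exists_common_isWeaklyRegular hA₁ hA₂ hω₁ hω₂ hd₁ hd₂
  have hmem₁ : ∀ r ∈ rs.map E.p₁, r ∈ maximalIdeal A₁ := List.forall_mem_map.mpr fun b hb =>
    (E.map_mem_maximalIdeal_iff b).mpr (hmem b hb)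
  have hmem₂ : ∀ r ∈ rs.map E.p₂, r ∈ maximalIdeal A₂ := List.forall_mem_map.mpr fun b hb =>
    (E.swap.map_mem_maximalIdeal_iff b).mpr (hmem b hb)
  have hreg₁ := (E.isWeaklyRegular_quotient_iff rs).mp hQ₁
  have hreg₂ := (E.swap.isWeaklyRegular_quotient_iff rs).mp hQ₂
  have hω₁reg := (E.isWeaklyRegular_ker_iff rs).mpr hK₂
  have hω₂reg := (E.swap.isWeaklyRegular_ker_iff rs).mpr hK₁
  obtain ⟨k₁, hk₁⟩ := exists_maximalIdeal_pow_le hmem₁ hreg₁ (by simpa using hd₁)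
  obtain ⟨k₂, hk₂⟩ := exists_maximalIdeal_pow_le hmem₂ hreg₂ (by simpa using hd₂)
  obtain ⟨e, -, he, hsoc⟩ := exists_socle_generator hω₂reg hmem₂
    (hω₂.type_eq_one _ (by simpa using hd₂))
  -- `m ^ k₁ ≤ (rs) + ker p₁` and `m ^ k₂ ≤ (rs) + ker p₂`, and `ker p₁ * ker p₂ = 0`
  refine ⟨rs, k₁ + k₂, E.i₂ e, hmem, hB, ?_, fun r hr => ?_, fun b hb => ?_⟩
  · rw [pow_add]
    have h₁ := maximalIdeal_pow_le_sup_ker E.surjective_p₁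
      (fun b => (E.map_mem_maximalIdeal_iff b).mpr) hk₁
    have h₂ := maximalIdeal_pow_le_sup_ker E.surjective_p₂
      (fun b => (E.swap.map_mem_maximalIdeal_iff b).mpr) hk₂
    refine (Ideal.mul_mono h₁ h₂).trans ?_
    rw [Ideal.sup_mul, Ideal.mul_sup, Ideal.mul_sup, E.ker_mul_ker]
    exact sup_le (sup_le Ideal.mul_le_right Ideal.mul_le_left) (sup_le Ideal.mul_le_right bot_le)
  · rw [E.mul_i₂]
    exact E.swap.i₁_mem_ofList (he _ ((E.swap.map_mem_maximalIdeal_iff r).mpr hr))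
  · have hann : ∀ x : ω₁, E.p₁ b • x ∈ (Ideal.ofList (rs.map E.p₁) • ⊤ : Submodule A₁ ω₁) := by
      intro x
      refine E.mem_smul_top_of_i₁_mem hQ₂ ?_
      rw [← E.mul_i₁, mul_comm]
      refine hb _ (le_maximalIdeal (RingHom.ker_ne_top E.p₂) ?_)
      exact E.exact₂.apply_apply_eq_zero x
    have hmemb := mem_ofList_of_smul_mem hmem₁ hreg₁ hk₁ hω₁reg hω₁.injectiveDimension_lt_top
      (hω₁.type_eq_one _ (by simpa using hd₁)) hann
    rw [← Ideal.map_ofList, Ideal.mem_map_iff_of_surjective _ E.surjective_p₁] at hmemb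
    obtain ⟨j, hj, hjb⟩ := hmemb
    obtain ⟨w, hw⟩ := (E.exact₁ (b - j)).mp (by rw [map_sub, hjb, sub_self])
    obtain ⟨c, hc⟩ := hsoc w fun r hr => by
      obtain ⟨r, rfl⟩ := E.surjective_p₂ r
      refine E.swap.mem_smul_top_of_i₁_mem hQ₁ ?_
      change E.i₂ (E.p₂ r • w) ∈ _
      rw [← E.mul_i₂, hw, mul_sub]
      exact sub_mem (hb r ((E.swap.map_mem_maximalIdeal_iff r).mp hr)) (Ideal.mul_mem_left _ _ hj)
    obtain ⟨c, rfl⟩ := E.surjective_p₂ c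
    refine ⟨c, ?_⟩
    have := E.swap.i₁_mem_ofList hc
    change E.i₂ (w - E.p₂ c • e) ∈ _ at this
    rw [map_sub, hw, ← E.mul_i₂] at this
    have := add_mem this hj
    rwa [show b - j - c * E.i₂ e + j = b - c * E.i₂ e by ring] at this

end LocalCase

/-! ### Localizations of a double extension -/

section Gorenstein

variable {A₁ : Type u₁} [CommRing A₁] [IsLocalRing A₁] {A₂ : Type u₂} [CommRing A₂]
  {ω₁ : Type u₁} [AddCommGroup ω₁] [Module A₁ ω₁] {ω₂ : Type u₂} [AddCommGroup ω₂] [Module A₂ ω₂]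
  {B : Type v} [CommRing B] [IsNoetherianRing B]

/-- If `ker p₂` is not contained in `P`, then the localization of `B` at `P` is `A₁`, and `ω₁` is
isomorphic to `A₁`. -/
lemma DoubleExtension.isGorensteinLocalRing_of_not_le (E : DoubleExtension A₁ A₂ ω₁ ω₂ B)
    (hA₁ : IsCohenMacaulayLocalRing A₁) (hω₁ : IsDualizingModule A₁ ω₁) (P : Ideal B)
    [P.IsMaximal] (h : ¬ RingHom.ker E.p₂ ≤ P) :
    IsGorensteinLocalRing (Localization.AtPrime P) := by
  have := hA₁.isNoetherianRing
  obtain ⟨φ⟩ := E.nonempty_linearEquiv h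
  let _ := E.p₁.toAlgebra
  have : IsLocalization.AtPrime A₁ P := E.isLocalization_atPrime h
  refine ⟨inferInstance, IsLocalization.isNoetherianRing P.primeCompl _ inferInstance, ?_⟩
  rw [injectiveDimension_self_congr
    (IsLocalization.algEquiv P.primeCompl (Localization.AtPrime P) A₁).toRingEquiv]
  exact (hω₁.hasGorensteinReduction hA₁ φ).injectiveDimension_lt_top

/-- If `P` contains both `ker p₁` and `ker p₂`, then `B` is local with maximal ideal `P`. -/
lemma DoubleExtension.isGorensteinLocalRing_of_le [IsLocalRing A₂]
    (E : DoubleExtension A₁ A₂ ω₁ ω₂ B)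
    (hA₁ : IsCohenMacaulayLocalRing A₁) (hA₂ : IsCohenMacaulayLocalRing A₂)
    (hω₁ : IsDualizingModule A₁ ω₁) (hω₂ : IsDualizingModule A₂ ω₂)
    (hdim : ringKrullDim A₁ = ringKrullDim A₂) (P : Ideal B)
    [hP : P.IsMaximal] (h₁ : RingHom.ker E.p₁ ≤ P) (h₂ : RingHom.ker E.p₂ ≤ P) :
    IsGorensteinLocalRing (Localization.AtPrime P) := by
  have hlocal : IsLocalRing B := IsLocalRing.of_unique_max_ideal ⟨P, hP, fun Q hQ => by
    rcases E.ker_le_or_ker_le hQ.isPrime with h | h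
    · rw [E.eq_comap_maximalIdeal hQ h, ← E.eq_comap_maximalIdeal hP h₁]
    · rw [E.swap.eq_comap_maximalIdeal hQ h, ← E.swap.eq_comap_maximalIdeal hP h₂]⟩
  have hunit : P.primeCompl ≤ IsUnit.submonoid B := fun b hb => by
    rw [IsUnit.mem_submonoid_iff]
    by_contra hu
    exact hb (eq_maximalIdeal hP ▸ (mem_maximalIdeal b).mpr hu)
  refine ⟨inferInstance, IsLocalization.isNoetherianRing P.primeCompl _ inferInstance, ?_⟩
  rw [← injectiveDimension_self_congr
    (IsLocalization.atUnits B P.primeCompl (S := Localization.AtPrime P) hunit).toRingEquiv]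
  exact (E.hasGorensteinReduction hA₁ hA₂ hω₁ hω₂ hdim).injectiveDimension_lt_top

end Gorenstein

end LinkageExtension

theorem mainTheorem1
    {A₁ : Type u₁} [CommRing A₁] [IsLocalRing A₁]
    {A₂ : Type u₂} [CommRing A₂] [IsLocalRing A₂]
    {ω₁ : Type u₁} [AddCommGroup ω₁] [Module A₁ ω₁]
    {ω₂ : Type u₂} [AddCommGroup ω₂] [Module A₂ ω₂]
    {B : Type v} [CommRing B]
    (hA₁ : LinkageExtension.IsCohenMacaulayLocalRing A₁)
    (hA₂ : LinkageExtension.IsCohenMacaulayLocalRing A₂)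
    (heq₁ : LinkageExtension.IsEquidimensional A₁)
    (heq₂ : LinkageExtension.IsEquidimensional A₂)
    (hdim : ringKrullDim A₁ = ringKrullDim A₂)
    (hω₁ : LinkageExtension.IsDualizingModule A₁ ω₁)
    (hω₂ : LinkageExtension.IsDualizingModule A₂ ω₂)
    (E : LinkageExtension.DoubleExtension A₁ A₂ ω₁ ω₂ B) :
    LinkageExtension.IsGorensteinRing B := by
  have := hA₁.isNoetherianRing
  have := hA₂.isNoetherianRing
  have := hω₁.finite
  have := E.isNoetherianRing
  refine ⟨this, fun P _ => ?_⟩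
  by_cases h₂ : RingHom.ker E.p₂ ≤ P
  · by_cases h₁ : RingHom.ker E.p₁ ≤ P
    · exact E.isGorensteinLocalRing_of_le hA₁ hA₂ hω₁ hω₂ hdim P h₁ h₂
    · exact E.swap.isGorensteinLocalRing_of_not_le hA₂ hω₂ P h₁
  · exact E.isGorensteinLocalRing_of_not_le hA₁ hω₁ P h₂
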